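/- **Setting.** Let $(\mathcal X,\mathcal A,P,C,D)$ be a finite MDP with cost $C$, constraint cost $D$, an absorbing target state $x_{\rm Tar}$ at which $C=D=0$, and initial state $x^0\neq x_{\rm Tar}$; assume that for some $T\in\mathbb N$ the hitting time of $x_{\rm Tar}$ is at most $T$ almost surely, for every stationary policy and every initial state. Fix a tolerance $\alpha\in\mathbb R$. The augmented process starts at $(x_0,s_0)=(x^0,\alpha)$; from $(x,s)$ with $x\ne x_{\rm Tar}$, under action $a$, it moves to $(x',s-D(x,a))$ with probability $P(x'|x,a)$; the episode ends after the stage at which $x_{\rm Tar}$ is hit, at $(x_{\rm Tar},s_{\rm Tar})$. For $\lambda\ge 0$ the stage cost is $\bar C_\lambda(x,s,a)=C(x,a)$ if $x\neq x_{\rm Tar}$ and $\lambda\mathbf 1\{s\le 0\}$ if $x=x_{\rm Tar}$. Let $\bar{\mathcal X}'$ be the finite set of augmented states that can occur during an episode (the final states $(x_{\rm Tar},s_{\rm Tar})$ included), and $\bar P$ the transition probabilities between states of $\bar{\mathcal X}'$ (zero out of the final states). For $\theta\in\Theta\subseteq\mathbb R^{\kappa'}$ let $\mu(\cdot|x,s;\theta)$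 be a randomized policy, let $d^\theta(x,s)=\sum_{t\ge0}\mathbb P(x_t=x,s_t=s,\ \text{episode not over before stage } t)$ be the occupation measure, $\|V\|_{d^\theta}^2=\sum_{\bar{\mathcal X}'}d^\theta V^2$, and $$B_{\theta,\lambda}[V](x,s)=\sum_{a}\mu(a|x,s;\theta)\Big\{\bar C_\lambda(x,s,a)+\sum_{(x',s')\in\bar{\mathcal X}'}\bar P(x',s'|x,s,a)V(x',s')\Big\}.$$ Let $\phi(x,s)\in\mathbb R^{\kappa}$ be feature vectors, $(\Phi v)(x,s)=\phi(x,s)^\top v$, and assume that for each $\theta\in\Theta$ the $\kappa$ basis functions are linearly independent on $\{(x,s)\in\bar{\mathcal X}':d^\theta(x,s)>0\}$. Let $\Pi_\theta$ be the $\|\cdot\|_{d^\theta}$-projection onto $\{\Phi v:v\in\mathbb R^{\kappa}\}$. Let $\zeta_1,\zeta_2,\zeta_3>0$ be step sizes with $\sum_k\zeta_i(k)=\infty$, $\sum_k\zeta_i(k)^2<\infty$, $\zeta_1=o(\zeta_2)$, $\zeta_2=o(\zeta_3)$. In the $k$-th episode $(x_h,s_h,a_h)_{h\ge 0}$, which is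 sampled (given the past) under $\mu(\cdot|\cdot;\theta_k)$ and hits the target at time $\tau\le T$, put $\delta_h(v)=\bar C_{\lambda_k}(x_h,s_h,a_h)+v^\top\phi(x_{h+1},s_{h+1})-v^\top\phi(x_h,s_h)$ for $h<\tau$, and $\delta_\tau(v)=\bar C_{\lambda_k}(x_\tau,s_\tau,a_\tau)-v^\top\phi(x_\tau,s_\tau)$. The critic update, from a deterministic $v_0$, is $$v_{k+1}=v_k+\zeta_3(k)\sum_{h=0}^{\tau}\phi(x_h,s_h)\,\delta_h(v_k).$$ **Theorem.** 1. For all $\theta\in\Theta$, $\lambda\ge0$ there is a unique $v^*=v^*(\theta,\lambda)$ such that $\Phi v^*=\Pi_\theta B_{\theta,\lambda}[\Phi v^*]$ on $\bar{\mathcal X}'$. It is the unique minimizer over $v$ of the projected Bellman residual $\|\Pi_\theta B_{\theta,\lambda}[\Phi v]-\Phi v\|_{d^\theta}^2$; and whenever the Bellman residual $\|B_{\theta,\lambda}[\Phi v]-\Phi v\|_{d^\theta}^2$ vanishes for some $v$, $v^*$ is also the unique minimizer of the Bellman residual. 2. If the policy parameter and the multiplier are held at $\theta_k=\theta\in\Theta$,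 $\lambda_k=\lambda\ge 0$, then $v_k\to v^*(\theta,\lambda)$ almost surely. 3. Let $\Theta$ be compact and convex, and for all $a\in\mathcal A$, $(x,s)\in\bar{\mathcal X}'$ let $\mu(a|x,s;\theta)$ be positive for $\theta\in\Theta$ and continuously differentiable in $\theta$ around each point of $\Theta$. Let $(\theta_k,\lambda_k)$ be updated alongside the critic, from deterministic $\theta_0\in\Theta$, $\lambda_0\in[0,\lambda_{\max}]$, by $\theta_{k+1}=\Gamma_\Theta\big(\theta_k-\zeta_2(k)\sum_{h=0}^{\tau}\nabla_\theta\log\mu(a_h|x_h,s_h;\theta)|_{\theta=\theta_k}\delta_h(v_k)\big)$ and $\lambda_{k+1}=\Gamma_{[0,\lambda_{\max}]}\big(\lambda_k+\zeta_1(k)(-\beta+\mathbf 1\{s_{\rm Tar}\le0\})\big)$, where $\beta\in\mathbb R$ and $\Gamma_K$ is the Euclidean projection to $K$. Then $v_k-v^*(\theta_k,\lambda_k)\to0$ almost surely. -/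

import Mathlib

open Filter Topology MeasureTheory
open scoped RealInnerProductSpace

/-- The finite chance-constrained decision problem: a finite Markov decision process with
cost `C`, constraint cost `D`, an absorbing target state at which both costs vanish, a
non-target initial state, and the cost tolerance `tol` of the chance constraint
(the event to be controlled is that the total constraint cost is at least `tol`). -/
structure ChanceMDP (X A : Type*) [Fintype X] where
  /-- transition probabilities `P x a x'` -/
  P : X → A → X → ℝ
  P_nonneg : ∀ x a x', 0 ≤ P x a x'
  P_sum : ∀ x a, ∑ x', P x a x' = 1
  C : X → A → ℝ
  D : X → A → ℝ
  xTar : X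
  x0 : X
  x0_ne : x0 ≠ xTar
  P_tar : ∀ a, P xTar a xTar = 1
  C_tar : ∀ a, C xTar a = 0
  D_tar : ∀ a, D xTar a = 0
  tol : ℝ

/-- `π y a` is, for every state `y ∈ s`, a probability distribution over actions. -/
def IsPolicyOn {Y A : Type*} [Fintype A] (s : Set Y) (π : Y → A → ℝ) : Prop :=
  ∀ y ∈ s, (∀ a, 0 ≤ π y a) ∧ ∑ a, π y a = 1

/-- An episode is recorded as the first `T + 2` state-action pairs of the process; the part
that comes after the target has been hit is never used. -/
abbrev Episode (X A : Type*) (T : ℕ) : Type _ := Fin (T + 2) → X × A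

namespace ChanceMDP

noncomputable section

open Classical

variable {X A : Type*} [Fintype X] [Fintype A] (M : ChanceMDP X A)

/-- Transition matrix of the Markov chain induced by a stationary policy on `X`. -/
def chain (ρ : X → A → ℝ) : Matrix X X ℝ :=
  Matrix.of fun x x' => ∑ a, ρ x a * M.P x a x'

/-- The first-hitting time of the target is at most `T` almost surely, for all stationary
policies and all initial states. (The target is absorbing, so the hitting time is at most `T`
exactly if the chain is at the target at time `T`.) -/
def HittingTimeBounded (T : ℕ) : Prop :=
  ∀ ρ : X → A → ℝ, IsPolicyOn Set.univ ρ → ∀ x, (M.chain ρ ^ T) x M.xTar = 1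

/-! ### The augmented MDP -/

/-- Cost of the augmented MDP. -/
def augCost (lam : ℝ) (y : X × ℝ) (a : A) : ℝ :=
  if y.1 = M.xTar then (if y.2 ≤ 0 then lam else 0) else M.C y.1 a

/-- Transitions of the augmented MDP between transient augmented states. From `(x, s)` with
`x` not the target, `s` moves to `s - D x a`. An augmented state `(xTar, s)` is the last state
of an episode: all mass goes from it to the absorbing post-episode state, which is cost-free
and not a transient state, so the row of `(xTar, s)` is zero here. -/
def augP (y : X × ℝ) (a : A) (y' : X × ℝ) : ℝ :=
  if y.1 = M.xTar then 0
  else if y'.2 = y.2 - M.D y.1 a then M.P y.1 a y'.1 else 0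

/-- Augmented states that can be reached from `(x0, tol)` in exactly `n` steps of one episode. -/
def reach : ℕ → Finset (X × ℝ)
  | 0 => {(M.x0, M.tol)}
  | n + 1 => (reach n).biUnion fun y =>
      if y.1 = M.xTar then ∅
      else ((Finset.univ : Finset (A × X)).filter fun p => 0 < M.P y.1 p.1 p.2).image
        fun p => (p.2, y.2 - M.D y.1 p.1)

/-- The finite set of transient augmented states: those which can occur during an episode
(the state `(xTar, sTar)` at which the episode ends included). -/
def augStates (T : ℕ) : Finset (X × ℝ) := (Finset.range (T + 1)).biUnion M.reach

/-- Probability under the policy `π` that stage `t` of the episode is reached (the target was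
not hit before time `t`) and the augmented state is then `y`. -/
def stateProb (T : ℕ) (π : X × ℝ → A → ℝ) : ℕ → X × ℝ → ℝ
  | 0, y => if y = (M.x0, M.tol) then 1 else 0
  | t + 1, y' => ∑ y ∈ M.augStates T, stateProb T π t y * ∑ a, π y a * M.augP y a y'

/-- The (undiscounted) occupation measure: total visiting probability of `y`. -/
def occ (T : ℕ) (π : X × ℝ → A → ℝ) (y : X × ℝ) : ℝ := ∑' t, M.stateProb T π t y

/-- The undiscounted stopping Bellman operator. -/
def bellman (T : ℕ) (π : X × ℝ → A → ℝ) (lam : ℝ) (V : X × ℝ → ℝ) (y : X × ℝ) : ℝ :=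
  ∑ a, π y a * (M.augCost lam y a + ∑ y' ∈ M.augStates T, M.augP y a y' * V y')

/-! ### Linear value function approximation -/

/-- The approximate value function `Φ v`. -/
def lin {κ : ℕ} (φ : X × ℝ → EuclideanSpace ℝ (Fin κ)) (v : EuclideanSpace ℝ (Fin κ)) :
    X × ℝ → ℝ := fun y => ⟪φ y, v⟫

/-- The basis functions are linearly independent (`Φ` has full column rank) as functions on the
augmented states that are visited under `π`. -/
def IndependentFeatures (T : ℕ) (π : X × ℝ → A → ℝ) {κ : ℕ}
    (φ : X × ℝ → EuclideanSpace ℝ (Fin κ)) : Prop :=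
  LinearIndependent ℝ fun (i : Fin κ) (y : {y // y ∈ M.augStates T ∧ 0 < M.occ T π y}) => φ y i

/-- `‖V‖²` in the norm weighted by the occupation measure. -/
def normSq (T : ℕ) (π : X × ℝ → A → ℝ) (V : X × ℝ → ℝ) : ℝ :=
  ∑ y ∈ M.augStates T, M.occ T π y * V y ^ 2

/-- `Φ w` is a best approximation of `V` in the space `{Φ v}`, in the weighted norm. -/
def IsBestApprox (T : ℕ) (π : X × ℝ → A → ℝ) {κ : ℕ} (φ : X × ℝ → EuclideanSpace ℝ (Fin κ))
    (V : X × ℝ → ℝ) (w : EuclideanSpace ℝ (Fin κ)) : Prop :=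
  ∀ u, M.normSq T π (V - lin φ w) ≤ M.normSq T π (V - lin φ u)

/-- The occupation measure is nonnegative. -/
theorem occ_nonneg {T : ℕ} {π : X × ℝ → A → ℝ} (hπ : IsPolicyOn (M.augStates T) π)
    (y : X × ℝ) : 0 ≤ M.occ T π y := by
  have hP : ∀ y a y', 0 ≤ M.augP y a y' := by
    intro y a y'
    unfold augP
    split_ifs
    exacts [le_rfl, M.P_nonneg _ _ _, le_rfl]
  have h : ∀ t y, 0 ≤ M.stateProb T π t y := by
    intro t
    induction t with
    | zero => intro y; unfold stateProb; split_ifs <;> norm_num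
    | succ t ih =>
      intro y'
      unfold stateProb
      exact Finset.sum_nonneg fun y hy => mul_nonneg (ih y) (Finset.sum_nonneg fun a _ =>
        mul_nonneg ((hπ y hy).1 a) (hP _ _ _))
  exact tsum_nonneg fun t => h t y

/-- Best approximations exist, so the choice in the next definition is a genuine one. -/
theorem exists_isBestApprox {T : ℕ} {π : X × ℝ → A → ℝ} (hπ : IsPolicyOn (M.augStates T) π)
    {κ : ℕ} (φ : X × ℝ → EuclideanSpace ℝ (Fin κ)) (V : X × ℝ → ℝ) :
    ∃ w, M.IsBestApprox T π φ V w := by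
  let e : (X × ℝ → ℝ) →ₗ[ℝ] EuclideanSpace ℝ (M.augStates T) :=
    { toFun := fun f => WithLp.toLp 2 fun y => Real.sqrt (M.occ T π y) * f y
      map_add' := by intro f g; ext y; simp [mul_add]
      map_smul' := by intro c f; ext y; simp; ring }
  let L : EuclideanSpace ℝ (Fin κ) →ₗ[ℝ] (X × ℝ → ℝ) :=
    { toFun := fun v => lin φ v
      map_add' := by intro f g; ext y; simp [lin, inner_add_right]
      map_smul' := by intro c f; ext y; simp [lin, inner_smul_right] }
  have he : ∀ f, M.normSq T π f = ‖e f‖ ^ 2 := by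
    intro f
    rw [EuclideanSpace.norm_sq_eq, normSq, ← Finset.sum_coe_sort]
    refine Finset.sum_congr rfl fun y _ => ?_
    simp [e, mul_pow, Real.sq_sqrt (M.occ_nonneg hπ _)]
  obtain ⟨z, hz, hmin⟩ := (LinearMap.range (e ∘ₗ L)).exists_norm_eq_iInf_of_complete_subspace
    (Submodule.complete_of_finiteDimensional _) (e V)
  obtain ⟨w, rfl⟩ := hz
  refine ⟨w, fun u => ?_⟩
  rw [he, he, map_sub, map_sub]
  have h1 : ‖e V - e (lin φ w)‖ ≤ ‖e V - e (lin φ u)‖ := by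
    refine (le_of_eq hmin).trans ?_
    exact ciInf_le (f := fun q : LinearMap.range (e ∘ₗ L) => ‖e V - q‖)
      ⟨0, by rintro _ ⟨q, rfl⟩; exact norm_nonneg _⟩ ⟨(e ∘ₗ L) u, ⟨u, rfl⟩⟩
  gcongr

/-- The projection `Π` onto `{Φ v}` with respect to the weighted norm. -/
def proj (T : ℕ) (π : X × ℝ → A → ℝ) {κ : ℕ} (φ : X × ℝ → EuclideanSpace ℝ (Fin κ))
    (V : X × ℝ → ℝ) : X × ℝ → ℝ :=
  lin φ (Classical.epsilon (M.IsBestApprox T π φ V))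

/-- `Φ v` is a fixed point of the projected Bellman operator. -/
def IsProjFixedPoint (T : ℕ) (π : X × ℝ → A → ℝ) (lam : ℝ) {κ : ℕ}
    (φ : X × ℝ → EuclideanSpace ℝ (Fin κ)) (v : EuclideanSpace ℝ (Fin κ)) : Prop :=
  ∀ y ∈ M.augStates T, lin φ v y = M.proj T π φ (M.bellman T π lam (lin φ v)) y

/-- The squared Bellman residual `‖B[Φ v] - Φ v‖²`. -/
def residual (T : ℕ) (π : X × ℝ → A → ℝ) (lam : ℝ) {κ : ℕ}
    (φ : X × ℝ → EuclideanSpace ℝ (Fin κ)) (v : EuclideanSpace ℝ (Fin κ)) : ℝ :=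
  M.normSq T π (M.bellman T π lam (lin φ v) - lin φ v)

/-- The squared projected Bellman residual `‖Π B[Φ v] - Φ v‖²`. -/
def projResidual (T : ℕ) (π : X × ℝ → A → ℝ) (lam : ℝ) {κ : ℕ}
    (φ : X × ℝ → EuclideanSpace ℝ (Fin κ)) (v : EuclideanSpace ℝ (Fin κ)) : ℝ :=
  M.normSq T π (M.proj T π φ (M.bellman T π lam (lin φ v)) - lin φ v)

/-! ### Episodes and the actor-critic updates -/

section Episodes

variable {T : ℕ}

/-- The augmented state `(x_h, s_h)`, with `s_h = tol - ∑_{j < h} D x_j a_j`. -/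
def stateAt (ξ : Episode X A T) (h : Fin (T + 2)) : X × ℝ :=
  ((ξ h).1, M.tol - ∑ j ∈ Finset.univ.filter (· < h), M.D (ξ j).1 (ξ j).2)

/-- Probability of the episode `ξ` under the policy `π`. -/
def episodeProb (π : X × ℝ → A → ℝ) (ξ : Episode X A T) : ℝ :=
  (if (ξ 0).1 = M.x0 then 1 else 0) * (∏ h, π (M.stateAt ξ h) (ξ h).2) *
    ∏ h : Fin (T + 1), M.P (ξ h.castSucc).1 (ξ h.castSucc).2 (ξ h.succ).1

/-- The stages of the episode: those up to and including the first visit to the target. -/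
def stages (ξ : Episode X A T) : Finset (Fin (T + 1)) :=
  Finset.univ.filter fun h => ∀ j < h, (ξ j.castSucc).1 ≠ M.xTar

/-- Temporal difference error of stage `h`. After the stage at the target the episode is over,
and the continuation value is zero. -/
def tdError {κ : ℕ} (φ : X × ℝ → EuclideanSpace ℝ (Fin κ)) (lam : ℝ)
    (v : EuclideanSpace ℝ (Fin κ)) (ξ : Episode X A T) (h : Fin (T + 1)) : ℝ :=
  M.augCost lam (M.stateAt ξ h.castSucc) (ξ h.castSucc).2
    + (if (ξ h.castSucc).1 = M.xTar then 0 else lin φ v (M.stateAt ξ h.succ))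
    - lin φ v (M.stateAt ξ h.castSucc)

/-- Increment of the critic after an episode. -/
def criticStep {κ : ℕ} (φ : X × ℝ → EuclideanSpace ℝ (Fin κ)) (lam : ℝ)
    (v : EuclideanSpace ℝ (Fin κ)) (ξ : Episode X A T) : EuclideanSpace ℝ (Fin κ) :=
  ∑ h ∈ M.stages ξ, M.tdError φ lam v ξ h • φ (M.stateAt ξ h.castSucc)

/-- Increment of the policy parameter after an episode. -/
def actorStep {κ κ' : ℕ} (φ : X × ℝ → EuclideanSpace ℝ (Fin κ))
    (μ : EuclideanSpace ℝ (Fin κ') → X × ℝ → A → ℝ) (lam : ℝ) (v : EuclideanSpace ℝ (Fin κ))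
    (θ : EuclideanSpace ℝ (Fin κ')) (ξ : Episode X A T) : EuclideanSpace ℝ (Fin κ') :=
  ∑ h ∈ M.stages ξ, M.tdError φ lam v ξ h •
    gradient (fun θ' => Real.log (μ θ' (M.stateAt ξ h.castSucc) (ξ h.castSucc).2)) θ

/-- The value of `s` when the target is hit (`s` does not change at the target, and the target
is hit before the last recorded stage). -/
def sTar (ξ : Episode X A T) : ℝ := (M.stateAt ξ (Fin.last (T + 1))).2

end Episodes

end

end ChanceMDP

/-- `p` is the Euclidean projection of `z` to `K`. -/
def IsNearest {E : Type*} [NormedAddCommGroup E] (K : Set E) (z p : E) : Prop :=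
  p ∈ K ∧ ∀ q ∈ K, ‖z - p‖ ≤ ‖z - q‖

/-- Step sizes: non-summable, square summable, `ζ₁ = o(ζ₂)` and `ζ₂ = o(ζ₃)`. -/
structure StepSizes (ζ₁ ζ₂ ζ₃ : ℕ → ℝ) : Prop where
  pos : ∀ k, 0 < ζ₁ k ∧ 0 < ζ₂ k ∧ 0 < ζ₃ k
  not_summable : ¬ Summable ζ₁ ∧ ¬ Summable ζ₂ ∧ ¬ Summable ζ₃
  sq_summable : (Summable fun k => ζ₁ k ^ 2) ∧ (Summable fun k => ζ₂ k ^ 2) ∧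
    Summable fun k => ζ₃ k ^ 2
  isLittleO₁₂ : ζ₁ =o[atTop] ζ₂
  isLittleO₂₃ : ζ₂ =o[atTop] ζ₃

/-- The episodic critic iteration along policy parameters `θ k` and multipliers `lam k`: given
the past `ℱ k`, the `k`-th episode is sampled from the augmented MDP under the policy `μ (θ k)`,
and then the critic makes a TD step with step size `ζ k`. -/
structure IsCriticRun {X A : Type*} [Fintype X] [Fintype A] (M : ChanceMDP X A) {T κ κ' : ℕ}
    (φ : X × ℝ → EuclideanSpace ℝ (Fin κ)) (μ : EuclideanSpace ℝ (Fin κ') → X × ℝ → A → ℝ)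
    (ζ : ℕ → ℝ) {Ω : Type*} {mΩ : MeasurableSpace Ω} (ℙ : Measure Ω) (ℱ : Filtration ℕ mΩ)
    (θ : ℕ → Ω → EuclideanSpace ℝ (Fin κ')) (lam : ℕ → Ω → ℝ)
    (v : ℕ → Ω → EuclideanSpace ℝ (Fin κ)) (ξ : ℕ → Ω → Episode X A T) : Prop where
  init : ∃ v₀, ∀ ω, v 0 ω = v₀
  measurable : ∀ k η, MeasurableSet[ℱ (k + 1)] (ξ k ⁻¹' {η})
  sample : ∀ k η, ℙ[(ξ k ⁻¹' {η}).indicator (fun _ => (1 : ℝ)) | ℱ k]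
    =ᵐ[ℙ] fun ω => M.episodeProb (μ (θ k ω)) η
  update : ∀ k ω, v (k + 1) ω = v k ω + ζ k • M.criticStep φ (lam k ω) (v k ω) (ξ k ω)

/-- The episodic actor updates: projected steps of the policy parameter in `Θ` and of the
multiplier in `[0, lamMax]`. -/
structure IsActorRun {X A : Type*} [Fintype X] [Fintype A] (M : ChanceMDP X A) {T κ κ' : ℕ}
    (φ : X × ℝ → EuclideanSpace ℝ (Fin κ)) (μ : EuclideanSpace ℝ (Fin κ') → X × ℝ → A → ℝ)
    (ζ₁ ζ₂ : ℕ → ℝ) (Θ : Set (EuclideanSpace ℝ (Fin κ'))) (lamMax β : ℝ) {Ω : Type*}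
    (θ : ℕ → Ω → EuclideanSpace ℝ (Fin κ')) (lam : ℕ → Ω → ℝ)
    (v : ℕ → Ω → EuclideanSpace ℝ (Fin κ)) (ξ : ℕ → Ω → Episode X A T) : Prop where
  init : ∃ θ₀ ∈ Θ, ∃ lam₀ ∈ Set.Icc 0 lamMax, ∀ ω, θ 0 ω = θ₀ ∧ lam 0 ω = lam₀
  update_θ : ∀ k ω, IsNearest Θ
    (θ k ω - ζ₂ k • M.actorStep φ μ (lam k ω) (v k ω) (θ k ω) (ξ k ω)) (θ (k + 1) ω)
  update_lam : ∀ k ω, IsNearest (Set.Icc 0 lamMax)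
    (lam k ω + ζ₁ k * (-β + if M.sTar (ξ k ω) ≤ 0 then 1 else 0)) (lam (k + 1) ω)

set_option linter.unusedSectionVars false

/-! Write `d` for the occupation measure, `P` for the substochastic matrix of the policy on the
augmented states, `B` for the Bellman operator. The mean of the critic increment over an episode is
`Φᵀ d (B[Φ v] - Φ v)`, that is `b - A v` with `A = Φᵀ d (1 - P) Φ`
(`HittingTimeBounded.meanStep_eq`, `drift`). Everything rests on positivity of `A`, which is not
symmetric. There is no discount, so `P` need not be a strict contraction, but flow balance gives `d
P ≤ d`, and with Jensen `P` is nonexpansive in the `d`-norm. For `f = Φ u` this yields `2⟨f - P f,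
f⟩ ≥ ‖f - P f‖²`. If the left side is not positive, then `f = P f` on the support of `d`; as every
episode ends by time `T`, backward recursion forces `f = 0` there, and independence of the features
gives `u = 0` (`HittingTimeBounded.inner_drift_pos`).

Hence `A` is invertible and `b - A v` has exactly one zero `v*`. By the normal equations of the
projection, being this zero is the same as solving the projected Bellman equation; this gives the
first claim.

For the convergence claims put `w = v - v*(θ, λ)`. Then `w` follows `w - ζ₃ A w + ζ₃ N + Δ`, with
`N` a martingale difference of linear growth and `Δ` the displacement of `v*`. On compact `Θ`, `A`
is uniformly positive and `v*` is Lipschitz, so `Δ` is at most `ε ζ₃ (1 + ‖w‖)` with `ε → 0` by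
separation of time scales. Since `ε` need not be summable along the steps, the argument has two
stages (`ae_tendsto_zero_of_stochasticApproximation`): second moments of `w` are bounded, so `∑ ζ₃
N` is an `L²`-bounded martingale and converges; then, path by path, subtracting the tail of this
series leaves a perturbed contraction. A frozen policy is the case of a one-point parameter set and
`Δ = 0`. -/

namespace ChanceMDP

/-! ### Reachable augmented states and the occupation measure -/

section Reachability

variable {X A : Type*} [Fintype X] [Fintype A] (M : ChanceMDP X A)

theorem mem_reach_succ {n : ℕ} {y' : X × ℝ} :
    y' ∈ M.reach (n + 1) ↔ ∃ y ∈ M.reach n, y.1 ≠ M.xTar ∧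
      ∃ a, 0 < M.P y.1 a y'.1 ∧ y'.2 = y.2 - M.D y.1 a := by
  classical
  simp only [reach, Finset.mem_biUnion]
  refine exists_congr fun y => and_congr_right fun _ => ?_
  by_cases hy : y.1 = M.xTar
  · simp [hy]
  · simp only [hy, if_false, Finset.mem_image, Finset.mem_filter, Finset.mem_univ, true_and,
      Prod.exists, ne_eq, not_false_eq_true]
    constructor
    · rintro ⟨a, x', h, rfl⟩
      exact ⟨a, h, rfl⟩
    · rintro ⟨a, h, h2⟩
      exact ⟨a, y'.1, h, by rw [← h2]⟩

theorem P_tar_ne {a : A} {x : X} (hx : x ≠ M.xTar) : M.P M.xTar a x = 0 := by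
  classical
  have h := M.P_sum M.xTar a
  rw [← Finset.add_sum_erase _ _ (Finset.mem_univ M.xTar), M.P_tar] at h
  have h0 : ∑ x ∈ Finset.univ.erase M.xTar, M.P M.xTar a x = 0 := by linarith
  exact (Finset.sum_eq_zero_iff_of_nonneg fun x _ => M.P_nonneg _ _ _).1 h0 x (by simp [hx])

theorem chain_pow_nonneg [DecidableEq X] {ρ : X → A → ℝ} (hρ : IsPolicyOn Set.univ ρ) (n : ℕ)
    (x x' : X) : 0 ≤ (M.chain ρ ^ n) x x' := by
  induction n generalizing x' with
  | zero => simp only [pow_zero, Matrix.one_apply]; split_ifs <;> norm_num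
  | succ n ih =>
    rw [pow_succ, Matrix.mul_apply]
    exact Finset.sum_nonneg fun z _ => mul_nonneg (ih z) (Finset.sum_nonneg fun a _ =>
      mul_nonneg ((hρ z trivial).1 a) (M.P_nonneg _ _ _))

theorem chain_pow_row_sum [DecidableEq X] {ρ : X → A → ℝ} (hρ : IsPolicyOn Set.univ ρ) (n : ℕ)
    (x : X) : ∑ x', (M.chain ρ ^ n) x x' = 1 := by
  induction n with
  | zero => simp [Matrix.one_apply]
  | succ n ih =>
    simp_rw [pow_succ, Matrix.mul_apply]
    rw [Finset.sum_comm, ← ih]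
    refine Finset.sum_congr rfl fun z _ => ?_
    rw [← Finset.mul_sum]
    simp only [chain, Matrix.of_apply]
    rw [Finset.sum_comm]
    simp_rw [← Finset.mul_sum, M.P_sum, mul_one]
    rw [(hρ z trivial).2, mul_one]

/-- The uniform policy on `X`. -/
noncomputable def uniformPolicy (X A : Type*) [Fintype A] : X → A → ℝ :=
  fun _ _ => (Fintype.card A : ℝ)⁻¹

theorem isPolicyOn_uniformPolicy [Nonempty A] : IsPolicyOn Set.univ (uniformPolicy X A) := by
  intro x _
  refine ⟨fun a => by unfold uniformPolicy; positivity, ?_⟩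
  simp [uniformPolicy]

/-- The uniform policy charges every action, so it sees every possible path. -/
theorem chain_pow_pos_of_mem_reach [DecidableEq X] [Nonempty A] {n : ℕ} {y : X × ℝ}
    (hy : y ∈ M.reach n) : 0 < (M.chain (uniformPolicy X A) ^ n) M.x0 y.1 := by
  induction n generalizing y with
  | zero =>
    rw [reach, Finset.mem_singleton] at hy
    simp [hy]
  | succ n ih =>
    obtain ⟨z, hz, -, a, ha, -⟩ := M.mem_reach_succ.1 hy
    rw [pow_succ, Matrix.mul_apply]
    have hu : ∀ (x : X) (a : A), 0 < uniformPolicy X A x a := fun x a => by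
      unfold uniformPolicy; positivity
    refine Finset.sum_pos' (fun x _ => mul_nonneg
      (M.chain_pow_nonneg isPolicyOn_uniformPolicy n _ _)
      (Finset.sum_nonneg fun a _ => mul_nonneg (hu _ _).le (M.P_nonneg _ _ _)))
      ⟨z.1, Finset.mem_univ _, mul_pos (ih hz) ?_⟩
    exact Finset.sum_pos' (fun a _ => mul_nonneg (hu _ _).le (M.P_nonneg _ _ _))
      ⟨a, Finset.mem_univ _, mul_pos (hu _ _) ha⟩

variable {M} {T : ℕ}

/-- Under the uniform policy the target has all the mass at time `T`, which leaves none for another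
reachable state. -/
theorem HittingTimeBounded.eq_xTar [Nonempty A] (hT : M.HittingTimeBounded T) {y : X × ℝ}
    (hy : y ∈ M.reach T) : y.1 = M.xTar := by
  classical
  by_contra hne
  have h1 := hT _ isPolicyOn_uniformPolicy M.x0
  have h2 := M.chain_pow_row_sum (isPolicyOn_uniformPolicy) T M.x0
  have h3 : 0 < (M.chain (uniformPolicy X A) ^ T) M.x0 y.1 := M.chain_pow_pos_of_mem_reach hy
  have h4 : (M.chain (uniformPolicy X A) ^ T) M.x0 M.xTar = 1 := by convert h1
  rw [← Finset.add_sum_erase _ _ (Finset.mem_univ M.xTar), h4] at h2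
  have h0 : ∑ x ∈ Finset.univ.erase M.xTar, (M.chain (uniformPolicy X A) ^ T) M.x0 x = 0 := by
    linarith
  have := (Finset.sum_eq_zero_iff_of_nonneg fun x _ =>
    M.chain_pow_nonneg isPolicyOn_uniformPolicy T _ x).1 h0 y.1 (by simp [hne])
  exact h3.ne' this

theorem HittingTimeBounded.reach_eq_empty [Nonempty A] (hT : M.HittingTimeBounded T) {n : ℕ}
    (hn : T < n) : M.reach n = ∅ := by
  induction n, hn using Nat.le_induction with
  | base =>
    refine Finset.eq_empty_of_forall_notMem fun y hy => ?_
    obtain ⟨z, hz, hne, -⟩ := M.mem_reach_succ.1 hy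
    exact hne (hT.eq_xTar hz)
  | succ n _ ih =>
    refine Finset.eq_empty_of_forall_notMem fun y hy => ?_
    obtain ⟨z, hz, -⟩ := M.mem_reach_succ.1 hy
    simp [ih] at hz

theorem mem_augStates {y : X × ℝ} : y ∈ M.augStates T ↔ ∃ n ≤ T, y ∈ M.reach n := by
  classical
  simp [augStates]

theorem HittingTimeBounded.mem_augStates_of_mem_reach [Nonempty A] (hT : M.HittingTimeBounded T)
    {n : ℕ} {y : X × ℝ} (hy : y ∈ M.reach n) : y ∈ M.augStates T := by
  refine mem_augStates.2 ⟨n, ?_, hy⟩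
  by_contra! h
  simp [hT.reach_eq_empty h] at hy

variable (M T) in
theorem init_mem_augStates : (M.x0, M.tol) ∈ M.augStates T :=
  mem_augStates.2 ⟨0, Nat.zero_le _, by simp [reach]⟩

/-- Recorded episodes run on after the target is hit. Absorption and `D = 0` make them stay at the
same augmented state, so closure holds there too, although `augP` vanishes. -/
theorem HittingTimeBounded.next_mem_augStates [Nonempty A] (hT : M.HittingTimeBounded T)
    {y : X × ℝ} (hy : y ∈ M.augStates T) {a : A} {x' : X} (h : 0 < M.P y.1 a x') :
    (x', y.2 - M.D y.1 a) ∈ M.augStates T := by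
  by_cases hx : y.1 = M.xTar
  · rw [hx] at h ⊢
    have hx' : x' = M.xTar := by
      by_contra hne
      exact h.ne' (M.P_tar_ne hne)
    rw [M.D_tar, sub_zero, hx', ← hx]
    exact hy
  · obtain ⟨n, -, hn⟩ := mem_augStates.1 hy
    exact hT.mem_augStates_of_mem_reach (n := n + 1) (M.mem_reach_succ.2 ⟨y, hn, hx, a, h, rfl⟩)

theorem augP_nonneg (y : X × ℝ) (a : A) (y' : X × ℝ) : 0 ≤ M.augP y a y' := by
  unfold augP
  split_ifs
  exacts [le_rfl, M.P_nonneg _ _ _, le_rfl]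

theorem stateProb_nonneg {π : X × ℝ → A → ℝ} (hπ : IsPolicyOn (M.augStates T) π) (t : ℕ)
    (y : X × ℝ) : 0 ≤ M.stateProb T π t y := by
  induction t generalizing y with
  | zero => unfold stateProb; split_ifs <;> norm_num
  | succ t ih =>
    unfold stateProb
    exact Finset.sum_nonneg fun y hy => mul_nonneg (ih y) (Finset.sum_nonneg fun a _ =>
      mul_nonneg ((hπ y hy).1 a) (augP_nonneg _ _ _))

theorem mem_reach_of_stateProb_ne_zero {π : X × ℝ → A → ℝ} {t : ℕ} {y : X × ℝ}
    (h : M.stateProb T π t y ≠ 0) : y ∈ M.reach t := by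
  induction t generalizing y with
  | zero =>
    unfold stateProb at h
    simp only [ne_eq, ite_eq_right_iff, one_ne_zero, imp_false, not_not] at h
    simp [reach, h]
  | succ t ih =>
    unfold stateProb at h
    obtain ⟨z, -, hz⟩ := Finset.exists_ne_zero_of_sum_ne_zero h
    obtain ⟨a, -, ha⟩ := Finset.exists_ne_zero_of_sum_ne_zero (right_ne_zero_of_mul hz)
    have ha := right_ne_zero_of_mul ha
    unfold augP at ha
    split_ifs at ha with h1 h2
    · exact absurd rfl ha
    · exact M.mem_reach_succ.2 ⟨z, ih (left_ne_zero_of_mul hz), h1, a,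
        lt_of_le_of_ne (M.P_nonneg _ _ _) (Ne.symm ha), h2⟩
    · exact absurd rfl ha

theorem HittingTimeBounded.stateProb_eq_zero [Nonempty A] (hT : M.HittingTimeBounded T)
    (π : X × ℝ → A → ℝ) {t : ℕ} (ht : T < t) (y : X × ℝ) : M.stateProb T π t y = 0 := by
  by_contra h
  simpa [hT.reach_eq_empty ht] using mem_reach_of_stateProb_ne_zero h

theorem HittingTimeBounded.occ_eq_sum [Nonempty A] (hT : M.HittingTimeBounded T)
    (π : X × ℝ → A → ℝ) (y : X × ℝ) :
    M.occ T π y = ∑ t ∈ Finset.range (T + 1), M.stateProb T π t y := by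
  unfold occ
  refine tsum_eq_sum fun t ht => hT.stateProb_eq_zero π ?_ y
  simpa using ht

/-- Flow balance of the occupation measure. -/
theorem HittingTimeBounded.occ_eq_add [Nonempty A] (hT : M.HittingTimeBounded T)
    (π : X × ℝ → A → ℝ) (y' : X × ℝ) :
    M.occ T π y' = M.stateProb T π 0 y' +
      ∑ y ∈ M.augStates T, M.occ T π y * ∑ a, π y a * M.augP y a y' := by
  have h : M.occ T π y' = ∑ t ∈ Finset.range (T + 1 + 1), M.stateProb T π t y' := by
    rw [Finset.sum_range_succ, hT.stateProb_eq_zero π (Nat.lt_succ_self T), add_zero,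
      hT.occ_eq_sum]
  rw [h, Finset.sum_range_succ', add_comm]
  congr 1
  simp_rw [hT.occ_eq_sum, Finset.sum_mul]
  rw [Finset.sum_comm]
  rfl

/-- The new slack is a function of the state and the action, so the successors are indexed by `x'`
alone. Vector values are needed for critic increments. -/
theorem HittingTimeBounded.sum_augP_smul [Nonempty A] {E : Type*} [AddCommGroup E] [Module ℝ E]
    (hT : M.HittingTimeBounded T) {y : X × ℝ} (hy : y ∈ M.augStates T) (hx : y.1 ≠ M.xTar) (a : A)
    (V : X × ℝ → E) : ∑ y' ∈ M.augStates T, M.augP y a y' • V y' =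
      ∑ x', M.P y.1 a x' • V (x', y.2 - M.D y.1 a) := by
  classical
  symm
  refine Finset.sum_bij_ne_zero (fun x' _ _ => (x', y.2 - M.D y.1 a)) ?_ ?_ ?_ ?_
  · intro x' _ h
    refine hT.next_mem_augStates hy (lt_of_le_of_ne (M.P_nonneg _ _ _) (Ne.symm ?_))
    rintro h0
    simp [h0] at h
  · intro x _ _ x' _ _ h
    simpa using h
  · intro y' _ h
    unfold augP at h
    rw [if_neg hx] at h
    split_ifs at h with h2
    · refine ⟨y'.1, Finset.mem_univ _, ?_, ?_⟩
      · rw [← h2]; exact h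
      · rw [← h2]
    · simp at h
  · intro x' _ _
    simp [augP, hx]

end Reachability

/-! ### Path expectations by first-step analysis -/

section Paths

variable {X A : Type*} [Fintype X] [Fintype A] (M : ChanceMDP X A)

/-- The augmented state at stage `h` of a finite path that starts with slack `y.2`. -/
def pathState {n : ℕ} (y : X × ℝ) (ξ : Fin (n + 1) → X × A) (h : Fin (n + 1)) : X × ℝ :=
  ((ξ h).1, y.2 - ∑ j with j < h, M.D (ξ j).1 (ξ j).2)

open Classical in
/-- Probability of a finite path from `y` under the policy `π`. -/
noncomputable def pathProb {n : ℕ} (π : X × ℝ → A → ℝ) (y : X × ℝ) (ξ : Fin (n + 1) → X × A) : ℝ :=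
  (if (ξ 0).1 = y.1 then 1 else 0) * (∏ h, π (M.pathState y ξ h) (ξ h).2) *
    ∏ h : Fin n, M.P (ξ h.castSucc).1 (ξ h.castSucc).2 (ξ h.succ).1

open Classical in
/-- Sum of `g` along the transitions of a path up to the one out of the first target state. -/
noncomputable def pathSum {E : Type*} [AddCommGroup E] {n : ℕ} (g : X × ℝ → A → X × ℝ → E)
    (y : X × ℝ) (ξ : Fin (n + 1) → X × A) : E :=
  ∑ h : Fin n with ∀ j < h, (ξ j.castSucc).1 ≠ M.xTar,
    g (M.pathState y ξ h.castSucc) (ξ h.castSucc).2 (M.pathState y ξ h.succ)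

theorem pathState_zero {n : ℕ} (y : X × ℝ) (ξ : Fin (n + 1) → X × A) :
    M.pathState y ξ 0 = ((ξ 0).1, y.2) := by
  simp [pathState]

/-- Only the slack of the starting state enters `pathState`, hence `x'` is free. -/
theorem pathState_cons_succ {n : ℕ} (y : X × ℝ) (p : X × A) (ξ : Fin (n + 1) → X × A)
    (h : Fin (n + 1)) (x' : X) :
    M.pathState y (Fin.cons p ξ : Fin (n + 2) → X × A) h.succ =
      M.pathState (x', y.2 - M.D p.1 p.2) ξ h := by
  simp only [pathState, Fin.cons_succ, Prod.mk.injEq, true_and]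
  rw [Finset.sum_filter, Fin.sum_univ_succ, Finset.sum_filter]
  simp [sub_sub]

theorem pathState_succ {n : ℕ} (y : X × ℝ) (ξ : Fin (n + 1) → X × A) (h : Fin n) :
    M.pathState y ξ h.succ = ((ξ h.succ).1, (M.pathState y ξ h.castSucc).2 -
      M.D (ξ h.castSucc).1 (ξ h.castSucc).2) := by
  simp only [pathState, sub_sub, Prod.mk.injEq, true_and]
  have : (Finset.univ.filter fun j => j < h.succ) =
      insert h.castSucc (Finset.univ.filter fun j => j < h.castSucc) := by
    ext j
    simp only [Finset.mem_filter, Finset.mem_univ, true_and, Finset.mem_insert, Fin.lt_def,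
      Fin.ext_iff, Fin.val_succ, Fin.val_castSucc]
    omega
  rw [this, Finset.sum_insert (by simp), add_comm]

theorem pathProb_cons {n : ℕ} (π : X × ℝ → A → ℝ) (y : X × ℝ) (a : A)
    (ξ : Fin (n + 1) → X × A) :
    M.pathProb π y (Fin.cons (y.1, a) ξ : Fin (n + 2) → X × A) =
      π y a * M.P y.1 a (ξ 0).1 * M.pathProb π ((ξ 0).1, y.2 - M.D y.1 a) ξ := by
  unfold pathProb
  have h1 := Fin.prod_univ_succ fun h : Fin (n + 2) =>
    π (M.pathState y (Fin.cons (y.1, a) ξ : Fin (n + 2) → X × A) h)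
      ((Fin.cons (y.1, a) ξ : Fin (n + 2) → X × A) h).2
  have h2 := Fin.prod_univ_succ fun h : Fin (n + 1) =>
    M.P ((Fin.cons (y.1, a) ξ : Fin (n + 2) → X × A) h.castSucc).1
      ((Fin.cons (y.1, a) ξ : Fin (n + 2) → X × A) h.castSucc).2
      ((Fin.cons (y.1, a) ξ : Fin (n + 2) → X × A) h.succ).1
  simp only [Fin.cons_zero, pathState_zero, Fin.cons_succ, Fin.castSucc_zero', ← Fin.succ_castSucc,
    M.pathState_cons_succ y (y.1, a) ξ _ (ξ 0).1] at h1 h2 ⊢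
  rw [h1, h2]
  simp only [if_true, one_mul]
  ring

theorem pathProb_eq_zero {n : ℕ} (π : X × ℝ → A → ℝ) {y : X × ℝ} {ξ : Fin (n + 1) → X × A}
    (h : (ξ 0).1 ≠ y.1) : M.pathProb π y ξ = 0 := by
  simp [pathProb, h]

theorem sum_path_succ {X A E : Type*} [Fintype X] [Fintype A] [AddCommGroup E] {n : ℕ}
    (f : (Fin (n + 1) → X × A) → E) :
    ∑ ξ, f ξ = ∑ x, ∑ a, ∑ ξ : Fin n → X × A, f (Fin.cons (x, a) ξ) := by
  rw [← (Fin.consEquiv fun _ => X × A).sum_comp, Fintype.sum_prod_type, Fintype.sum_prod_type]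
  rfl

/-- The Markov property at time one. An arbitrary starting state and length are what make induction
on the length possible. -/
theorem sum_pathProb_succ {E : Type*} [AddCommGroup E] [Module ℝ E] {n : ℕ}
    (π : X × ℝ → A → ℝ) (y : X × ℝ) (H : (Fin (n + 2) → X × A) → E) :
    ∑ ξ, M.pathProb π y ξ • H ξ = ∑ a, π y a • ∑ x', M.P y.1 a x' •
      ∑ ξ : Fin (n + 1) → X × A, M.pathProb π (x', y.2 - M.D y.1 a) ξ •
        H (Fin.cons (y.1, a) ξ) := by
  rw [sum_path_succ, Fintype.sum_eq_single y.1]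
  · refine Finset.sum_congr rfl fun a _ => ?_
    simp_rw [pathProb_cons, Finset.smul_sum]
    rw [Finset.sum_comm]
    refine Finset.sum_congr rfl fun ξ _ => ?_
    rw [Fintype.sum_eq_single (ξ 0).1]
    · simp only [smul_smul, mul_assoc]
    · intro x' hx'
      rw [M.pathProb_eq_zero π (y := (x', _)) hx'.symm]
      simp
  · intro x hx
    refine Finset.sum_eq_zero fun a _ => Finset.sum_eq_zero fun ξ _ => ?_
    rw [M.pathProb_eq_zero π (by simpa using hx), zero_smul]

theorem pathSum_cons {E : Type*} [AddCommGroup E] {n : ℕ} (g : X × ℝ → A → X × ℝ → E)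
    (y : X × ℝ) (a : A) (ξ : Fin (n + 1) → X × A) [Decidable (y.1 = M.xTar)] :
    M.pathSum g y (Fin.cons (y.1, a) ξ : Fin (n + 2) → X × A) =
      g y a ((ξ 0).1, y.2 - M.D y.1 a) + if y.1 = M.xTar then 0 else
        M.pathSum g ((ξ 0).1, y.2 - M.D y.1 a) ξ := by
  classical
  unfold pathSum
  rw [Finset.sum_filter, Fin.sum_univ_succ]
  congr 1
  · rw [if_pos (by simp)]
    rw [M.pathState_cons_succ y (y.1, a) ξ _ (ξ 0).1, pathState_zero]
    simp [pathState_zero]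
  · split_ifs with hy
    · refine Finset.sum_eq_zero fun h _ => if_neg fun hh => ?_
      exact hh 0 (Fin.succ_pos h) (by simpa using hy)
    · rw [Finset.sum_filter]
      refine Finset.sum_congr rfl fun h _ => ?_
      rw [← Fin.succ_castSucc, M.pathState_cons_succ y (y.1, a) ξ _ (ξ 0).1,
        M.pathState_cons_succ y (y.1, a) ξ _ (ξ 0).1]
      congr 1
      simp only [Fin.forall_fin_succ, Fin.castSucc_zero, Fin.cons_zero, Fin.succ_lt_succ_iff,
        ← Fin.succ_castSucc, Fin.cons_succ, Fin.succ_pos, eq_iff_iff]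
      simp [hy]

variable {M} {T : ℕ}

/-- The policy is normalized on `augStates` only, so the induction has to drop successors of
probability zero before it recurses. -/
theorem HittingTimeBounded.sum_pathProb [Nonempty A] (hT : M.HittingTimeBounded T)
    {π : X × ℝ → A → ℝ} (hπ : IsPolicyOn (M.augStates T) π) {y : X × ℝ} (hy : y ∈ M.augStates T)
    (n : ℕ) : ∑ ξ : Fin (n + 1) → X × A, M.pathProb π y ξ = 1 := by
  induction n generalizing y with
  | zero =>
    rw [sum_path_succ, Fintype.sum_eq_single y.1]
    · rw [← (hπ y hy).2]
      refine Finset.sum_congr rfl fun a _ => ?_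
      simp [pathProb, pathState]
    · intro x hx
      simp [pathProb, hx]
  | succ n ih =>
    have h := M.sum_pathProb_succ π y (n := n) fun _ => (1 : ℝ)
    simp only [smul_eq_mul, mul_one] at h
    rw [h, ← (hπ y hy).2]
    refine Finset.sum_congr rfl fun a _ => ?_
    conv_rhs => rw [← mul_one (π y a), ← M.P_sum y.1 a]
    congr 1
    refine Finset.sum_congr rfl fun x' _ => ?_
    rcases (M.P_nonneg y.1 a x').eq_or_lt with h0 | h0
    · simp [← h0]
    · rw [ih (hT.next_mem_augStates hy h0), mul_one]

open Classical in
-- A dynamic programming recursion: the zero rows of `augP` at the target match the stopping of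
-- `pathSum`.
theorem HittingTimeBounded.expect_pathSum_succ [Nonempty A] {E : Type*} [AddCommGroup E]
    [Module ℝ E] (hT : M.HittingTimeBounded T)
    {π : X × ℝ → A → ℝ} (hπ : IsPolicyOn (M.augStates T) π) {y : X × ℝ} (hy : y ∈ M.augStates T)
    (g : X × ℝ → A → X × ℝ → E) (n : ℕ) :
    ∑ ξ : Fin (n + 2) → X × A, M.pathProb π y ξ • M.pathSum g y ξ =
      ∑ a, π y a • ∑ x', M.P y.1 a x' • g y a (x', y.2 - M.D y.1 a) +
      ∑ a, π y a • ∑ y' ∈ M.augStates T, M.augP y a y' •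
        ∑ ξ : Fin (n + 1) → X × A, M.pathProb π y' ξ • M.pathSum g y' ξ := by
  rw [sum_pathProb_succ, ← Finset.sum_add_distrib]
  refine Finset.sum_congr rfl fun a _ => ?_
  rw [← smul_add]
  congr 1
  have key : ∀ x', M.P y.1 a x' • ∑ ξ : Fin (n + 1) → X × A,
      M.pathProb π (x', y.2 - M.D y.1 a) ξ •
        M.pathSum g y (Fin.cons (y.1, a) ξ : Fin (n + 2) → X × A) =
      M.P y.1 a x' • g y a (x', y.2 - M.D y.1 a) + M.P y.1 a x' •
        if y.1 = M.xTar then 0 else ∑ ξ : Fin (n + 1) → X × A,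
          M.pathProb π (x', y.2 - M.D y.1 a) ξ • M.pathSum g (x', y.2 - M.D y.1 a) ξ := by
    intro x'
    rcases (M.P_nonneg y.1 a x').eq_or_lt with h0 | h0
    · simp [← h0]
    rw [← smul_add]
    congr 1
    have h1 : ∀ ξ : Fin (n + 1) → X × A, M.pathProb π (x', y.2 - M.D y.1 a) ξ •
        M.pathSum g y (Fin.cons (y.1, a) ξ : Fin (n + 2) → X × A) =
        M.pathProb π (x', y.2 - M.D y.1 a) ξ • g y a (x', y.2 - M.D y.1 a) +
        if y.1 = M.xTar then 0 else
          M.pathProb π (x', y.2 - M.D y.1 a) ξ • M.pathSum g (x', y.2 - M.D y.1 a) ξ := by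
      intro ξ
      by_cases hx : (ξ 0).1 = x'
      · rw [M.pathSum_cons, hx, smul_add]
        split_ifs <;> simp
      · rw [M.pathProb_eq_zero π (y := (x', _)) hx]
        simp
    simp_rw [h1]
    rw [Finset.sum_add_distrib, ← Finset.sum_smul,
      hT.sum_pathProb hπ (hT.next_mem_augStates hy h0), one_smul]
    split_ifs <;> simp
  simp_rw [key]
  rw [Finset.sum_add_distrib]
  congr 1
  by_cases hx : y.1 = M.xTar
  · simp [hx, augP]
  · simp only [hx, if_false]
    rw [hT.sum_augP_smul hy hx a fun y' =>
      ∑ ξ : Fin (n + 1) → X × A, M.pathProb π y' ξ • M.pathSum g y' ξ]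

theorem sum_stateProb_succ_smul {E : Type*} [AddCommGroup E] [Module ℝ E]
    (π : X × ℝ → A → ℝ) (t : ℕ) (U : X × ℝ → E) :
    ∑ y ∈ M.augStates T, M.stateProb T π t y • ∑ a, π y a •
        ∑ y' ∈ M.augStates T, M.augP y a y' • U y' =
      ∑ y' ∈ M.augStates T, M.stateProb T π (t + 1) y' • U y' := by
  simp only [stateProb, Finset.sum_smul, Finset.smul_sum, Finset.mul_sum, smul_smul]
  rw [Finset.sum_comm (s := M.augStates T) (t := M.augStates T)]
  refine Finset.sum_congr rfl fun y _ => ?_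
  rw [Finset.sum_comm]

/-- Expected sums along an episode are integrals against the occupation measure. -/
theorem HittingTimeBounded.expect_pathSum [Nonempty A] {E : Type*} [AddCommGroup E]
    [Module ℝ E] (hT : M.HittingTimeBounded T)
    {π : X × ℝ → A → ℝ} (hπ : IsPolicyOn (M.augStates T) π) (g : X × ℝ → A → X × ℝ → E) :
    ∑ ξ : Fin (T + 2) → X × A, M.pathProb π (M.x0, M.tol) ξ • M.pathSum g (M.x0, M.tol) ξ =
      ∑ y ∈ M.augStates T, M.occ T π y •
        ∑ a, π y a • ∑ x', M.P y.1 a x' • g y a (x', y.2 - M.D y.1 a) := by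
  classical
  -- Starting the remaining `n` transitions from the law at time `t` makes the recursion close. At
  -- `t = 0` the law is a point mass, and `n = T + 1` covers all times that contribute to the
  -- occupation measure.
  have key : ∀ n t, ∑ y ∈ M.augStates T, M.stateProb T π t y •
        ∑ ξ : Fin (n + 1) → X × A, M.pathProb π y ξ • M.pathSum g y ξ =
      ∑ i ∈ Finset.range n, ∑ y ∈ M.augStates T, M.stateProb T π (t + i) y •
        ∑ a, π y a • ∑ x', M.P y.1 a x' • g y a (x', y.2 - M.D y.1 a) := by
    intro n
    induction n with
    | zero => intro t; simp [pathSum]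
    | succ n ih =>
      intro t
      rw [Finset.sum_congr rfl fun y hy => by rw [hT.expect_pathSum_succ hπ hy g n, smul_add],
        Finset.sum_add_distrib, sum_stateProb_succ_smul π t fun y =>
          ∑ ξ : Fin (n + 1) → X × A, M.pathProb π y ξ • M.pathSum g y ξ, ih (t + 1),
        Finset.sum_range_succ', add_comm]
      simp [add_comm, add_left_comm]
  have h0 := key (T + 1) 0
  rw [Finset.sum_eq_single_of_mem _ (M.init_mem_augStates T)] at h0
  · simp only [stateProb, if_true, one_smul] at h0
    rw [h0, Finset.sum_comm]
    refine Finset.sum_congr rfl fun y _ => ?_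
    rw [hT.occ_eq_sum, Finset.sum_smul]
    simp
  · intro y _ hy
    simp [stateProb, hy]

/-- Either a path is impossible under all policies or it stays in the set of augmented states. -/
theorem HittingTimeBounded.pathProb_eq_zero_or [Nonempty A] (hT : M.HittingTimeBounded T)
    {y : X × ℝ} (hy : y ∈ M.augStates T) {n : ℕ} (ξ : Fin (n + 1) → X × A) :
    (∀ π, M.pathProb π y ξ = 0) ∨ ∀ h, M.pathState y ξ h ∈ M.augStates T := by
  by_cases h0 : (ξ 0).1 = y.1
  swap
  · exact Or.inl fun π => M.pathProb_eq_zero π h0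
  by_cases hP : ∀ h : Fin n, 0 < M.P (ξ h.castSucc).1 (ξ h.castSucc).2 (ξ h.succ).1
  · right
    intro h
    induction h using Fin.induction with
    | zero => rw [pathState_zero, h0]; exact hy
    | succ h ih =>
      rw [pathState_succ]
      exact hT.next_mem_augStates ih (hP h)
  · left
    push Not at hP
    obtain ⟨h, hh⟩ := hP
    intro π
    have : M.P (ξ h.castSucc).1 (ξ h.castSucc).2 (ξ h.succ).1 = 0 :=
      le_antisymm hh (M.P_nonneg _ _ _)
    rw [pathProb, Finset.prod_eq_zero (Finset.mem_univ h) this, mul_zero]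

end Paths

end ChanceMDP

namespace ChanceMDP

/-! ### Positivity of the drift and the projected Bellman equation -/

section FixedPoint

variable {X A : Type*} [Fintype X] [Fintype A] (M : ChanceMDP X A) {T κ : ℕ}
  (φ : X × ℝ → EuclideanSpace ℝ (Fin κ)) {π : X × ℝ → A → ℝ}

theorem nonempty_of_isPolicyOn (hπ : IsPolicyOn (M.augStates T) π) : Nonempty A := by
  by_contra h
  rw [not_nonempty_iff] at h
  simpa using (hπ _ (M.init_mem_augStates T)).2

/-- Transition probabilities between transient augmented states under `π`. -/
noncomputable def transP (π : X × ℝ → A → ℝ) (y y' : X × ℝ) : ℝ := ∑ a, π y a * M.augP y a y'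

variable (T) in
/-- The expected continuation value under `π`. -/
noncomputable def contValue (π : X × ℝ → A → ℝ) (V : X × ℝ → ℝ) (y : X × ℝ) : ℝ :=
  ∑ y' ∈ M.augStates T, M.transP π y y' * V y'

variable (T) in
/-- The mean critic increment. -/
noncomputable def meanStep (π : X × ℝ → A → ℝ) (lam : ℝ) (v : EuclideanSpace ℝ (Fin κ)) :
    EuclideanSpace ℝ (Fin κ) :=
  ∑ ξ : Episode X A T, M.episodeProb π ξ • M.criticStep φ lam v ξ

open Classical in
/-- The linear part of the critic increment. -/
noncomputable def criticLin (ξ : Episode X A T) :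
    EuclideanSpace ℝ (Fin κ) →L[ℝ] EuclideanSpace ℝ (Fin κ) :=
  ∑ h ∈ M.stages ξ, ((if (ξ h.castSucc).1 = M.xTar then 0 else
    innerSL ℝ (φ (M.stateAt ξ h.succ))) - innerSL ℝ (φ (M.stateAt ξ h.castSucc))).smulRight
      (φ (M.stateAt ξ h.castSucc))

variable (T) in
/-- The matrix of the mean critic dynamics, `Φᵀ D (1 - P) Φ`. -/
noncomputable def drift (π : X × ℝ → A → ℝ) :
    EuclideanSpace ℝ (Fin κ) →L[ℝ] EuclideanSpace ℝ (Fin κ) :=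
  -∑ ξ : Episode X A T, M.episodeProb π ξ • M.criticLin φ ξ

theorem lin_zero : lin φ 0 = 0 := by ext y; simp [lin]

theorem lin_add (u v : EuclideanSpace ℝ (Fin κ)) : lin φ (u + v) = lin φ u + lin φ v := by
  ext y; simp [lin, inner_add_right]

theorem lin_sub (u v : EuclideanSpace ℝ (Fin κ)) : lin φ (u - v) = lin φ u - lin φ v := by
  ext y; simp [lin, inner_sub_right]

theorem lin_smul (c : ℝ) (v : EuclideanSpace ℝ (Fin κ)) : lin φ (c • v) = c • lin φ v := by
  ext y; simp [lin, inner_smul_right]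

/-- The temporal difference is affine in `v`, and the multiplier enters only the constant part. -/
theorem criticStep_eq_add (lam : ℝ) (v : EuclideanSpace ℝ (Fin κ)) (ξ : Episode X A T) :
    M.criticStep φ lam v ξ = M.criticStep φ lam 0 ξ + M.criticLin φ ξ v := by
  simp only [criticStep, criticLin, _root_.sum_apply, ← Finset.sum_add_distrib]
  refine Finset.sum_congr rfl fun h _ => ?_
  rw [ContinuousLinearMap.smulRight_apply, ← add_smul]
  congr 1
  simp only [tdError, lin]
  split_ifs <;> simp <;> ring

theorem meanStep_eq_sub (lam : ℝ) (v : EuclideanSpace ℝ (Fin κ)) :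
    M.meanStep T φ π lam v = M.meanStep T φ π lam 0 - M.drift T φ π v := by
  simp only [meanStep, drift, _root_.neg_apply, _root_.sum_apply,
    sub_neg_eq_add, ← Finset.sum_add_distrib]
  refine Finset.sum_congr rfl fun ξ _ => ?_
  rw [criticStep_eq_add, smul_add]
  rfl

theorem meanStep_sub (lam : ℝ) (v w : EuclideanSpace ℝ (Fin κ)) :
    M.meanStep T φ π lam v - M.meanStep T φ π lam w = -M.drift T φ π (v - w) := by
  rw [meanStep_eq_sub, M.meanStep_eq_sub φ lam w, map_sub]
  abel

theorem bellman_eq (lam : ℝ) (V : X × ℝ → ℝ) (y : X × ℝ) :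
    M.bellman T π lam V y = ∑ a, π y a * M.augCost lam y a + M.contValue T π V y := by
  simp only [bellman, contValue, transP, mul_add, Finset.sum_add_distrib, Finset.mul_sum,
    Finset.sum_mul]
  congr 1
  rw [Finset.sum_comm]
  simp only [mul_assoc]

variable {M} in
/-- The mean critic increment is the Bellman error weighted by the occupation measure. -/
theorem HittingTimeBounded.meanStep_eq (hT : M.HittingTimeBounded T)
    (hπ : IsPolicyOn (M.augStates T) π) (lam : ℝ) (v : EuclideanSpace ℝ (Fin κ)) :
    M.meanStep T φ π lam v = ∑ y ∈ M.augStates T, M.occ T π y •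
      ((M.bellman T π lam (lin φ v) y - lin φ v y) • φ y) := by
  classical
  have := M.nonempty_of_isPolicyOn hπ
  have h := hT.expect_pathSum hπ fun y a y' => (M.augCost lam y a +
    (if y.1 = M.xTar then 0 else lin φ v y') - lin φ v y) • φ y
  have h1 : M.meanStep T φ π lam v = ∑ ξ : Fin (T + 2) → X × A,
      M.pathProb π (M.x0, M.tol) ξ • M.pathSum (fun y a y' => (M.augCost lam y a +
    (if y.1 = M.xTar then 0 else lin φ v y') - lin φ v y) • φ y) (M.x0, M.tol) ξ := by
    -- `episodeProb` and `criticStep` unfold to `pathProb` and `pathSum` from the initial augmented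
    -- state, with `n = T + 1`.
    refine Finset.sum_congr rfl fun ξ _ => ?_
    congr 1
  rw [h1, h]
  refine Finset.sum_congr rfl fun y hy => ?_
  congr 1
  simp_rw [smul_smul, Finset.smul_sum, smul_smul, ← Finset.sum_smul]
  congr 1
  have hsum := (hπ y hy).2
  have : M.bellman T π lam (lin φ v) y - lin φ v y = ∑ a, π y a * (M.augCost lam y a +
      ∑ y' ∈ M.augStates T, M.augP y a y' * lin φ v y' - lin φ v y) := by
    simp only [mul_sub, Finset.sum_sub_distrib, ← Finset.sum_mul, hsum, one_mul, bellman]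
  rw [this]
  refine Finset.sum_congr rfl fun a _ => ?_
  simp_rw [← Finset.mul_sum]
  congr 1
  simp only [mul_sub, mul_add, Finset.sum_sub_distrib, Finset.sum_add_distrib, ← Finset.sum_mul,
    M.P_sum, one_mul]
  congr 2
  by_cases hx : y.1 = M.xTar
  · simp [hx, augP]
  · simp only [hx, if_false]
    exact (hT.sum_augP_smul hy hx a (lin φ v)).symm

theorem transP_nonneg (hπ : IsPolicyOn (M.augStates T) π) {y : X × ℝ} (hy : y ∈ M.augStates T)
    (y' : X × ℝ) : 0 ≤ M.transP π y y' :=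
  Finset.sum_nonneg fun a _ => mul_nonneg ((hπ y hy).1 a) (augP_nonneg _ _ _)

variable {M} in
-- Rows sum to one off the target and to zero at it.
theorem HittingTimeBounded.sum_transP_le (hT : M.HittingTimeBounded T)
    (hπ : IsPolicyOn (M.augStates T) π) {y : X × ℝ} (hy : y ∈ M.augStates T) :
    ∑ y' ∈ M.augStates T, M.transP π y y' ≤ 1 := by
  have := M.nonempty_of_isPolicyOn hπ
  simp only [transP]
  rw [Finset.sum_comm, ← (hπ y hy).2]
  refine Finset.sum_le_sum fun a _ => ?_
  rw [← Finset.mul_sum]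
  refine mul_le_of_le_one_right ((hπ y hy).1 a) ?_
  by_cases hx : y.1 = M.xTar
  · simp [hx, augP]
  · have := hT.sum_augP_smul hy hx a fun _ => (1 : ℝ)
    simp only [smul_eq_mul, mul_one, M.P_sum] at this
    exact this.le

variable {M} in
-- Jensen for subprobability weights, from Cauchy–Schwarz.
theorem HittingTimeBounded.sq_contValue_le (hT : M.HittingTimeBounded T)
    (hπ : IsPolicyOn (M.augStates T) π) (V : X × ℝ → ℝ) {y : X × ℝ} (hy : y ∈ M.augStates T) :
    M.contValue T π V y ^ 2 ≤ M.contValue T π (fun y' => V y' ^ 2) y := by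
  have h0 := M.transP_nonneg hπ hy
  have h1 := Finset.sum_sq_le_sum_mul_sum_of_sq_le_mul (M.augStates T)
    (r := fun y' => M.transP π y y' * V y') (f := fun y' => M.transP π y y')
    (g := fun y' => M.transP π y y' * V y' ^ 2) (fun y' _ => h0 y')
    (fun y' _ => mul_nonneg (h0 y') (sq_nonneg _)) (fun y' _ => (by ring : _ = _).le)
  refine h1.trans (mul_le_of_le_one_left ?_ (hT.sum_transP_le hπ hy))
  exact Finset.sum_nonneg fun y' _ => mul_nonneg (h0 y') (sq_nonneg _)

variable {M} in
-- Flow balance with the initial mass dropped. Applied to squares, with the previous inequality, it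
-- shows that continuation is nonexpansive in the weighted norm.
theorem HittingTimeBounded.sum_occ_contValue_le (hT : M.HittingTimeBounded T)
    (hπ : IsPolicyOn (M.augStates T) π) {V : X × ℝ → ℝ} (hV : ∀ y, 0 ≤ V y) :
    ∑ y ∈ M.augStates T, M.occ T π y * M.contValue T π V y ≤
      ∑ y ∈ M.augStates T, M.occ T π y * V y := by
  have := M.nonempty_of_isPolicyOn hπ
  simp only [contValue, Finset.mul_sum]
  rw [Finset.sum_comm]
  refine Finset.sum_le_sum fun y' _ => ?_
  simp_rw [← mul_assoc, ← Finset.sum_mul]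
  refine mul_le_mul_of_nonneg_right ?_ (hV y')
  conv_rhs => rw [hT.occ_eq_add]
  exact le_add_of_nonneg_left (stateProb_nonneg hπ 0 y')

variable {M} in
/-- A function that satisfies the cost-free Bellman equation where the occupation measure is
positive vanishes there. -/
theorem HittingTimeBounded.eq_zero_of_eq_contValue (hT : M.HittingTimeBounded T)
    (hπ : IsPolicyOn (M.augStates T) π) {f : X × ℝ → ℝ}
    (hf : ∀ y ∈ M.augStates T, 0 < M.occ T π y → f y = M.contValue T π f y)
    {y : X × ℝ} (hy : 0 < M.occ T π y) : f y = 0 := by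
  have := M.nonempty_of_isPolicyOn hπ
  -- Backward induction in time: after `T` no state carries mass, and a state charged at time `t`
  -- passes mass only to states charged at `t + 1`, where `f` already vanishes.
  have key : ∀ k t, T < t + k → ∀ y, M.stateProb T π t y ≠ 0 → f y = 0 := by
    intro k
    induction k with
    | zero => exact fun t ht y h => absurd (hT.stateProb_eq_zero π ht y) h
    | succ k ih =>
      intro t ht y h
      have hmem := hT.mem_augStates_of_mem_reach (mem_reach_of_stateProb_ne_zero h)
      have htT : t ≤ T := by
        by_contra! hlt
        exact h (hT.stateProb_eq_zero π hlt y)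
      have hpos : 0 < M.stateProb T π t y :=
        lt_of_le_of_ne (stateProb_nonneg hπ t y) (Ne.symm h)
      have hocc : 0 < M.occ T π y := by
        rw [hT.occ_eq_sum]
        exact Finset.sum_pos' (fun t _ => stateProb_nonneg hπ t y)
          ⟨t, Finset.mem_range.2 (Nat.lt_succ_of_le htT), hpos⟩
      rw [hf y hmem hocc]
      refine Finset.sum_eq_zero fun y' _ => ?_
      rcases (M.transP_nonneg hπ hmem y').eq_or_lt with h0 | h0
      · rw [← h0, zero_mul]
      · rw [ih (t + 1) (by omega) y', mul_zero]
        refine ne_of_gt ?_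
        exact Finset.sum_pos' (fun z hz => mul_nonneg (stateProb_nonneg hπ t z)
          (M.transP_nonneg hπ hz y')) ⟨y, hmem, mul_pos hpos h0⟩
  rw [hT.occ_eq_sum] at hy
  obtain ⟨t, -, ht⟩ := Finset.exists_ne_zero_of_sum_ne_zero hy.ne'
  exact key (T + 1) t (by omega) y ht

variable {M φ} in
theorem IndependentFeatures.eq_zero (hφ : M.IndependentFeatures T π φ)
    {u : EuclideanSpace ℝ (Fin κ)}
    (hu : ∀ y ∈ M.augStates T, 0 < M.occ T π y → lin φ u y = 0) : u = 0 := by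
  have h := Fintype.linearIndependent_iff.1 hφ (fun i => u i) ?_
  · ext i; simpa using h i
  · ext ⟨y, hy⟩
    have := hu y hy.1 hy.2
    simp only [lin, PiLp.inner_apply] at this
    simpa using this

theorem inner_meanStep (hT : M.HittingTimeBounded T) (hπ : IsPolicyOn (M.augStates T) π)
    (lam : ℝ) (v u : EuclideanSpace ℝ (Fin κ)) :
    ⟪M.meanStep T φ π lam v, u⟫ = ∑ y ∈ M.augStates T, M.occ T π y *
      ((M.bellman T π lam (lin φ v) y - lin φ v y) * lin φ u y) := by
  rw [hT.meanStep_eq φ hπ, sum_inner]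
  simp [real_inner_smul_left, lin]

theorem inner_drift (hT : M.HittingTimeBounded T) (hπ : IsPolicyOn (M.augStates T) π)
    (u : EuclideanSpace ℝ (Fin κ)) :
    ⟪M.drift T φ π u, u⟫ = ∑ y ∈ M.augStates T, M.occ T π y *
      ((lin φ u y - M.contValue T π (lin φ u) y) * lin φ u y) := by
  have h : M.drift T φ π u = M.meanStep T φ π 0 0 - M.meanStep T φ π 0 u := by
    rw [M.meanStep_eq_sub φ 0 u]; abel
  rw [h, inner_sub_left, inner_meanStep _ _ hT hπ, inner_meanStep _ _ hT hπ,
    ← Finset.sum_sub_distrib]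
  refine Finset.sum_congr rfl fun y _ => ?_
  simp only [bellman_eq, lin_zero, contValue, Pi.zero_apply, mul_zero, Finset.sum_const_zero]
  ring

variable {M φ} in
/-- The mean critic dynamics are strictly dissipative. -/
theorem HittingTimeBounded.inner_drift_pos (hT : M.HittingTimeBounded T)
    (hπ : IsPolicyOn (M.augStates T) π) (hφ : M.IndependentFeatures T π φ)
    {u : EuclideanSpace ℝ (Fin κ)} (hu : u ≠ 0) : 0 < ⟪M.drift T φ π u, u⟫ := by
  by_contra! hle
  refine hu (hφ.eq_zero fun y _ hy => ?_)
  refine hT.eq_zero_of_eq_contValue hπ (fun y hy hpos => ?_) hy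
  rw [inner_drift _ _ hT hπ] at hle
  have h1 := hT.sum_occ_contValue_le hπ (V := fun y => lin φ u y ^ 2) fun y => sq_nonneg _
  have h2 : ∑ y ∈ M.augStates T, M.occ T π y * M.contValue T π (lin φ u) y ^ 2 ≤
      ∑ y ∈ M.augStates T, M.occ T π y * M.contValue T π (fun y => lin φ u y ^ 2) y :=
    Finset.sum_le_sum fun y hy => mul_le_mul_of_nonneg_left (hT.sq_contValue_le hπ _ hy)
      (M.occ_nonneg hπ y)
  -- Polarization. By `h1` and `h2` the last two sums contribute at most zero, so `hle` forces the
  -- left side to vanish.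
  have h3 : ∑ y ∈ M.augStates T, M.occ T π y * (lin φ u y - M.contValue T π (lin φ u) y) ^ 2 =
      2 * ∑ y ∈ M.augStates T, M.occ T π y *
        ((lin φ u y - M.contValue T π (lin φ u) y) * lin φ u y) -
      ∑ y ∈ M.augStates T, M.occ T π y * lin φ u y ^ 2 +
      ∑ y ∈ M.augStates T, M.occ T π y * M.contValue T π (lin φ u) y ^ 2 := by
    rw [Finset.mul_sum, ← Finset.sum_sub_distrib, ← Finset.sum_add_distrib]
    exact Finset.sum_congr rfl fun y _ => by ring
  have h4 : ∀ y ∈ M.augStates T,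
      0 ≤ M.occ T π y * (lin φ u y - M.contValue T π (lin φ u) y) ^ 2 :=
    fun y _ => mul_nonneg (M.occ_nonneg hπ y) (sq_nonneg _)
  have h5 := (Finset.sum_eq_zero_iff_of_nonneg h4).1
    (le_antisymm (by linarith) (Finset.sum_nonneg h4)) y hy
  have h6 := (mul_eq_zero.1 h5).resolve_left hpos.ne'
  exact sub_eq_zero.1 (pow_eq_zero_iff two_ne_zero |>.1 h6)

variable {M φ} in
-- A positive drift is injective, hence bijective in finite dimension.
theorem HittingTimeBounded.existsUnique_meanStep_eq_zero (hT : M.HittingTimeBounded T)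
    (hπ : IsPolicyOn (M.augStates T) π) (hφ : M.IndependentFeatures T π φ) (lam : ℝ) :
    ∃! v, M.meanStep T φ π lam v = 0 := by
  have hinj : Function.Injective (M.drift T φ π) := by
    rw [injective_iff_map_eq_zero]
    intro u h0
    by_contra hu
    simpa [h0] using hT.inner_drift_pos hπ hφ hu
  have hsurj : Function.Surjective (M.drift T φ π) :=
    LinearMap.injective_iff_surjective (f := (M.drift T φ π).toLinearMap) |>.1 hinj
  obtain ⟨v, hv⟩ := hsurj (M.meanStep T φ π lam 0)
  refine ⟨v, by simp only [meanStep_eq_sub _ _ lam v, hv, sub_self], fun w hw => hinj ?_⟩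
  have hw : M.meanStep T φ π lam w = 0 := hw
  rw [meanStep_eq_sub, sub_eq_zero] at hw
  rw [hv, hw]

/-- The normal equations, by varying the minimizer along the line `w + t • u`. -/
theorem IsBestApprox.sum_eq_zero {V : X × ℝ → ℝ} {w : EuclideanSpace ℝ (Fin κ)}
    (hπ : IsPolicyOn (M.augStates T) π)
    (h : M.IsBestApprox T π φ V w) (u : EuclideanSpace ℝ (Fin κ)) :
    ∑ y ∈ M.augStates T, M.occ T π y * ((V y - lin φ w y) * lin φ u y) = 0 := by
  set I := ∑ y ∈ M.augStates T, M.occ T π y * ((V y - lin φ w y) * lin φ u y) with hI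
  set J := M.normSq T π (lin φ u) with hJ
  have hJ0 : 0 ≤ J := Finset.sum_nonneg fun y _ => mul_nonneg (M.occ_nonneg hπ y) (sq_nonneg _)
  have key : ∀ t : ℝ, 2 * t * I ≤ t ^ 2 * J := by
    intro t
    have h1 := h (w + t • u)
    have h2 : M.normSq T π (V - lin φ (w + t • u)) =
        M.normSq T π (V - lin φ w) - 2 * t * I + t ^ 2 * J := by
      simp only [hI, hJ, normSq, Finset.mul_sum, ← Finset.sum_sub_distrib,
        ← Finset.sum_add_distrib]
      refine Finset.sum_congr rfl fun y _ => ?_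
      simp only [lin_add, lin_smul, Pi.sub_apply, Pi.add_apply, Pi.smul_apply, smul_eq_mul]
      ring
    linarith
  -- The optimal `t` would be `I / J`; the `+ 1` avoids a case distinction when `J = 0`.
  have h3 := key (I / (J + 1))
  have hJ1 : 0 < J + 1 := by linarith
  have h4 : 2 * (I / (J + 1)) * I - (I / (J + 1)) ^ 2 * J =
      I ^ 2 * ((J + 2) / (J + 1) ^ 2) := by
    field_simp
    ring
  have h5 : I ^ 2 * ((J + 2) / (J + 1) ^ 2) ≤ 0 := by linarith
  have h6 : 0 < (J + 2) / (J + 1) ^ 2 := by positivity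
  have h7 : I ^ 2 = 0 := by nlinarith [sq_nonneg I]
  exact pow_eq_zero_iff two_ne_zero |>.1 h7

theorem normSq_eq_zero_iff (hπ : IsPolicyOn (M.augStates T) π) (V : X × ℝ → ℝ) :
    M.normSq T π V = 0 ↔ ∀ y ∈ M.augStates T, 0 < M.occ T π y → V y = 0 := by
  unfold normSq
  rw [Finset.sum_eq_zero_iff_of_nonneg fun y _ => mul_nonneg (M.occ_nonneg hπ y) (sq_nonneg _)]
  refine forall₂_congr fun y _ => ?_
  rw [mul_eq_zero, pow_eq_zero_iff two_ne_zero, (M.occ_nonneg hπ y).lt_iff_ne, or_iff_not_imp_left]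
  exact ⟨fun h h' => h (Ne.symm h'), fun h h' => h (Ne.symm h')⟩

theorem normSq_nonneg (hπ : IsPolicyOn (M.augStates T) π) (V : X × ℝ → ℝ) :
    0 ≤ M.normSq T π V :=
  Finset.sum_nonneg fun y _ => mul_nonneg (M.occ_nonneg hπ y) (sq_nonneg _)

variable {M φ} in
/-- The zero of the mean critic increment is characterized by the projected Bellman equation on
the support of the occupation measure. -/
theorem HittingTimeBounded.meanStep_eq_zero_iff (hT : M.HittingTimeBounded T)
    (hπ : IsPolicyOn (M.augStates T) π) (hφ : M.IndependentFeatures T π φ) (lam : ℝ)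
    (v : EuclideanSpace ℝ (Fin κ)) :
    M.meanStep T φ π lam v = 0 ↔
      Classical.epsilon (M.IsBestApprox T π φ (M.bellman T π lam (lin φ v))) = v := by
  set w := Classical.epsilon (M.IsBestApprox T π φ (M.bellman T π lam (lin φ v))) with hw
  have hbest : M.IsBestApprox T π φ (M.bellman T π lam (lin φ v)) w :=
    Classical.epsilon_spec (M.exists_isBestApprox hπ φ _)
  have h1 := fun u => hbest.sum_eq_zero M φ hπ u
  have h2 := M.inner_meanStep φ hT hπ lam v
  constructor
  · intro h0
    rw [← sub_eq_zero]
    refine hφ.eq_zero ((M.normSq_eq_zero_iff hπ _).1 ?_)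
    have h3 := h2 (w - v)
    rw [h0, inner_zero_left] at h3
    -- Both `B[Φ v] - Φ w` and `B[Φ v] - Φ v` are orthogonal to `Φ (w - v)`; the difference of the
    -- two relations is its squared norm.
    have h4 : M.normSq T π (lin φ (w - v)) = 0 - 0 := by
      nth_rewrite 1 [h3]
      rw [← h1 (w - v), normSq, ← Finset.sum_sub_distrib]
      refine Finset.sum_congr rfl fun y _ => ?_
      simp only [lin_sub, Pi.sub_apply]
      ring
    rw [h4, sub_zero]
  · intro h0
    rw [h0] at h1
    refine ext_inner_right ℝ fun u => ?_
    rw [h2, h1, inner_zero_left]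

variable {M φ} in
-- The equation is imposed also at unvisited states. This costs nothing, because independence on the
-- visited states identifies the coefficient vectors.
theorem HittingTimeBounded.isProjFixedPoint_iff (hT : M.HittingTimeBounded T)
    (hπ : IsPolicyOn (M.augStates T) π) (hφ : M.IndependentFeatures T π φ) (lam : ℝ)
    (v : EuclideanSpace ℝ (Fin κ)) :
    M.IsProjFixedPoint T π lam φ v ↔ M.meanStep T φ π lam v = 0 := by
  rw [hT.meanStep_eq_zero_iff hπ hφ]
  constructor
  · intro h
    rw [← sub_eq_zero]
    refine hφ.eq_zero fun y hy _ => ?_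
    rw [lin_sub, Pi.sub_apply, sub_eq_zero]
    exact (h y hy).symm
  · intro h y _
    rw [proj, h]

variable {M φ} in
theorem HittingTimeBounded.projResidual_eq_zero_iff (hT : M.HittingTimeBounded T)
    (hπ : IsPolicyOn (M.augStates T) π) (hφ : M.IndependentFeatures T π φ) (lam : ℝ)
    (v : EuclideanSpace ℝ (Fin κ)) :
    M.projResidual T π lam φ v = 0 ↔ M.meanStep T φ π lam v = 0 := by
  rw [hT.meanStep_eq_zero_iff hπ hφ, projResidual, proj, ← lin_sub]
  constructor
  · intro h
    rw [← sub_eq_zero]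
    exact hφ.eq_zero ((M.normSq_eq_zero_iff hπ _).1 h)
  · intro h
    rw [h, sub_self, lin_zero]
    simp [normSq]

variable {M φ} in
-- With zero residual the Bellman error vanishes wherever the mean increment puts weight.
theorem HittingTimeBounded.meanStep_eq_zero_of_residual (hT : M.HittingTimeBounded T)
    (hπ : IsPolicyOn (M.augStates T) π) {lam : ℝ} {v : EuclideanSpace ℝ (Fin κ)}
    (h : M.residual T π lam φ v = 0) : M.meanStep T φ π lam v = 0 := by
  rw [residual, normSq_eq_zero_iff _ hπ] at h
  rw [hT.meanStep_eq φ hπ]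
  refine Finset.sum_eq_zero fun y hy => ?_
  rcases (M.occ_nonneg hπ y).eq_or_lt with h0 | h0
  · rw [← h0, zero_smul]
  · have := h y hy h0
    rw [Pi.sub_apply] at this
    rw [this, zero_smul, smul_zero]

theorem isMinOn_univ_iff_eq_zero {E : Type*} {f : E → ℝ} (h0 : ∀ v, 0 ≤ f v) {v₀ : E}
    (hv₀ : f v₀ = 0) (v : E) : IsMinOn f Set.univ v ↔ f v = 0 := by
  rw [isMinOn_univ_iff]
  exact ⟨fun h => le_antisymm (hv₀ ▸ h v₀) (h0 v), fun h w => h ▸ h0 w⟩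

variable {M φ} in
/-- Three characterizations of the zero of the mean critic increment. -/
theorem HittingTimeBounded.fixedPoint_characterization (hT : M.HittingTimeBounded T)
    (hπ : IsPolicyOn (M.augStates T) π) (hφ : M.IndependentFeatures T π φ) {lam : ℝ}
    {v₀ : EuclideanSpace ℝ (Fin κ)} (hv₀ : M.meanStep T φ π lam v₀ = 0) :
    (∀ v, M.IsProjFixedPoint T π lam φ v ↔ v = v₀) ∧
    (∀ v, IsMinOn (M.projResidual T π lam φ) Set.univ v ↔ v = v₀) ∧
    ((∃ v, M.residual T π lam φ v = 0) →
      ∀ v, IsMinOn (M.residual T π lam φ) Set.univ v ↔ v = v₀) := by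
  have huniq : ∀ v, M.meanStep T φ π lam v = 0 ↔ v = v₀ := fun v =>
    ⟨fun h => (hT.existsUnique_meanStep_eq_zero hπ hφ lam).unique h hv₀, fun h => h ▸ hv₀⟩
  refine ⟨fun v => ?_, fun v => ?_, ?_⟩
  · rw [hT.isProjFixedPoint_iff hπ hφ, huniq]
  · rw [isMinOn_univ_iff_eq_zero (f := M.projResidual T π lam φ)
      (fun v => M.normSq_nonneg hπ _)
      ((hT.projResidual_eq_zero_iff hπ hφ lam v₀).2 hv₀), hT.projResidual_eq_zero_iff hπ hφ, huniq]
  · rintro ⟨v₁, hv₁⟩ v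
    have h1 := (huniq v₁).1 (hT.meanStep_eq_zero_of_residual hπ hv₁)
    rw [h1] at hv₁
    rw [isMinOn_univ_iff_eq_zero
      (f := M.residual T π lam φ)
      (fun v => M.normSq_nonneg hπ _) hv₁]
    exact ⟨fun h => (huniq v).1 (hT.meanStep_eq_zero_of_residual hπ h), fun h => h ▸ hv₁⟩

end FixedPoint

end ChanceMDP

/-! ### Dissipative linear stochastic approximation -/

section StochasticApproximation

/-- A perturbed contraction with non-summable step sizes converges to zero. -/
theorem tendsto_zero_of_le_one_sub_mul_add {z ζ ε : ℕ → ℝ} {c : ℝ} (hc : 0 < c)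
    (hζ : ∀ k, 0 < ζ k) (hζ0 : Tendsto ζ atTop (𝓝 0)) (hsum : ¬ Summable ζ)
    (hε : Tendsto ε atTop (𝓝 0)) (hz : ∀ k, 0 ≤ z k)
    (h : ∀ᶠ k in atTop, z (k + 1) ≤ (1 - c * ζ k) * z k + ζ k * (ε k * (1 + z k))) :
    Tendsto z atTop (𝓝 0) := by
  rw [Metric.tendsto_atTop']
  intro δ' hδ'
  obtain ⟨δ, hδ, rfl⟩ : ∃ δ : ℝ, 0 < δ ∧ δ' = 2 * δ := ⟨δ' / 2, by linarith, by ring⟩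
  -- The bound `c / 2` absorbs `ε k * z k` into half of the contraction, and `c * δ / 2` is what
  -- makes the remaining recursion exactly a contraction of `z k - δ`.
  have h1 : ∀ᶠ k in atTop, ε k < c / 2 ∧ ε k < c * δ / 2 :=
    (hε.eventually_lt_const (by positivity)).and (hε.eventually_lt_const (by positivity))
  have h2 : ∀ᶠ k in atTop, c / 2 * ζ k < 1 := by
    have : Tendsto (fun k => c / 2 * ζ k) atTop (𝓝 (c / 2 * 0)) := hζ0.const_mul _
    rw [mul_zero] at this
    exact this.eventually_lt_const one_pos
  obtain ⟨N, hN⟩ := eventually_atTop.1 (h.and (h1.and h2))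
  have hstep : ∀ k ≥ N, max (z (k + 1) - δ) 0 ≤ Real.exp (-(c / 2 * ζ k)) * max (z k - δ) 0 := by
    intro k hk
    obtain ⟨hr, ⟨he1, he2⟩, hs⟩ := hN k hk
    have hmax : 0 ≤ max (z k - δ) 0 := le_max_right _ _
    have hexp : 1 - c / 2 * ζ k ≤ Real.exp (-(c / 2 * ζ k)) := by
      have := Real.add_one_le_exp (-(c / 2 * ζ k)); linarith
    refine max_le ?_ (by positivity)
    calc z (k + 1) - δ ≤ (1 - c / 2 * ζ k) * (z k - δ) := by
          have e1 : ζ k * ε k ≤ ζ k * (c * δ / 2) := mul_le_mul_of_nonneg_left he2.le (hζ k).le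
          have e2 : ζ k * z k * ε k ≤ ζ k * z k * (c / 2) :=
            mul_le_mul_of_nonneg_left he1.le (mul_nonneg (hζ k).le (hz k))
          nlinarith
      _ ≤ (1 - c / 2 * ζ k) * max (z k - δ) 0 :=
          mul_le_mul_of_nonneg_left (le_max_left _ _) (by linarith)
      _ ≤ _ := mul_le_mul_of_nonneg_right hexp hmax
  have hbound : ∀ n, max (z (N + n) - δ) 0 ≤
      Real.exp (-(c / 2 * ∑ i ∈ Finset.range n, ζ (i + N))) * max (z N - δ) 0 := by
    intro n
    induction n with
    | zero => simp
    | succ n ih =>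
      refine (hstep (N + n) (Nat.le_add_right _ _)).trans ?_
      refine (mul_le_mul_of_nonneg_left ih (Real.exp_pos _).le).trans (le_of_eq ?_)
      rw [← mul_assoc, ← Real.exp_add, Finset.sum_range_succ, add_comm n N]
      congr 2
      ring
  have hS : Tendsto (fun n => ∑ i ∈ Finset.range n, ζ (i + N)) atTop atTop := by
    rw [← not_summable_iff_tendsto_nat_atTop_of_nonneg fun i => (hζ _).le]
    rwa [summable_nat_add_iff N]
  have hlim : Tendsto (fun n => Real.exp (-(c / 2 * ∑ i ∈ Finset.range n, ζ (i + N))) *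
      max (z N - δ) 0) atTop (𝓝 0) := by
    have := (Real.tendsto_exp_neg_atTop_nhds_zero.comp
      (hS.const_mul_atTop (half_pos hc))).mul_const (max (z N - δ) 0)
    simpa using this
  obtain ⟨n₀, hn₀⟩ := eventually_atTop.1 (hlim.eventually_lt_const hδ)
  refine ⟨N + n₀, fun k hk => ?_⟩
  obtain ⟨n, rfl⟩ := Nat.exists_eq_add_of_le (show N ≤ k by omega)
  have h3 := (hbound n).trans_lt (hn₀ n (by omega))
  have h4 := (le_max_left _ _).trans_lt h3
  rw [Real.dist_eq, sub_zero, abs_of_nonneg (hz _)]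
  linarith

variable {E : Type*} [NormedAddCommGroup E] [InnerProductSpace ℝ E]

theorem norm_sub_smul_sq_le {B : E →L[ℝ] E} {c K ζ : ℝ} (hζ : 0 ≤ ζ) (u : E)
    (hc : c * ‖u‖ ^ 2 ≤ ⟪B u, u⟫) (hK : ‖B u‖ ≤ K * ‖u‖) :
    ‖u - ζ • B u‖ ^ 2 ≤ (1 - 2 * c * ζ + K ^ 2 * ζ ^ 2) * ‖u‖ ^ 2 := by
  rw [norm_sub_sq_real, real_inner_smul_right, norm_smul, Real.norm_of_nonneg hζ,
    real_inner_comm]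
  have h1 : ‖B u‖ ^ 2 ≤ (K * ‖u‖) ^ 2 := by gcongr
  nlinarith [mul_le_mul_of_nonneg_left hc hζ, mul_le_mul_of_nonneg_left h1 (sq_nonneg ζ)]

/-- Pathwise convergence of a dissipative linear iteration when the noise is summable along the
step sizes. -/
theorem tendsto_zero_of_noise_sum_tendsto {ζ ε : ℕ → ℝ} {c K : ℝ} (hc : 0 < c) (hK : 0 ≤ K)
    (hζ : ∀ k, 0 < ζ k) (hζ0 : Tendsto ζ atTop (𝓝 0)) (hsum : ¬ Summable ζ)
    (hε0 : ∀ k, 0 ≤ ε k) (hε : Tendsto ε atTop (𝓝 0))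
    {w N Δ : ℕ → E} {B : ℕ → E →L[ℝ] E} (hBc : ∀ k u, c * ‖u‖ ^ 2 ≤ ⟪B k u, u⟫)
    (hBK : ∀ k u, ‖B k u‖ ≤ K * ‖u‖)
    (hrec : ∀ k, w (k + 1) = w k - ζ k • B k (w k) + ζ k • N k + Δ k)
    (hΔ : ∀ k, ‖Δ k‖ ≤ ε k * ζ k * (1 + ‖w k‖)) {m : E}
    (hm : Tendsto (fun n => ∑ k ∈ Finset.range n, ζ k • N k) atTop (𝓝 m)) :
    Tendsto w atTop (𝓝 0) := by
  -- Minus the tail of the noise series. In `w - R` the noise cancels, and what remains of it is `ζ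
  -- k • B k (R k)`, a perturbation of order `o(ζ k)`.
  set R : ℕ → E := fun n => ∑ k ∈ Finset.range n, ζ k • N k - m with hR
  have hR0 : Tendsto R atTop (𝓝 0) := by
    simpa [hR] using hm.sub_const m
  have hRsucc : ∀ k, R (k + 1) = R k + ζ k • N k := by
    intro k
    simp only [hR, Finset.sum_range_succ]
    abel
  suffices hz : Tendsto (fun k => w k - R k) atTop (𝓝 0) by
    simpa using hz.add hR0
  rw [tendsto_zero_iff_norm_tendsto_zero]
  have hRn : Tendsto (fun k => ‖R k‖) atTop (𝓝 0) := tendsto_zero_iff_norm_tendsto_zero.1 hR0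
  refine tendsto_zero_of_le_one_sub_mul_add
    (ε := fun k => K ^ 2 / 2 * ζ k + K * ‖R k‖ + ε k * (1 + ‖R k‖)) hc hζ hζ0 hsum ?_
    (fun k => norm_nonneg _) ?_
  · have := ((hζ0.const_mul (K ^ 2 / 2)).add (hRn.const_mul K)).add (hε.mul (hRn.const_add 1))
    simpa using this
  · have h2 : ∀ᶠ k in atTop, c * ζ k < 1 := by
      have : Tendsto (fun k => c * ζ k) atTop (𝓝 (c * 0)) := hζ0.const_mul _
      rw [mul_zero] at this
      exact this.eventually_lt_const one_pos
    filter_upwards [h2] with k hk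
    set z := w k - R k with hz
    have hw : w k = z + R k := by rw [hz]; abel
    have e1 : w (k + 1) - R (k + 1) = (z - ζ k • B k z) + (Δ k - ζ k • B k (R k)) := by
      rw [hrec, hRsucc, hw, map_add, smul_add]
      abel
    -- `1 - 2cζ + K²ζ²` is at most the square of `1 - cζ + K²ζ²/2`.
    have e2 : ‖z - ζ k • B k z‖ ≤ (1 - c * ζ k + K ^ 2 / 2 * ζ k ^ 2) * ‖z‖ := by
      have e3 := norm_sub_smul_sq_le (hζ k).le z (hBc k z) (hBK k z)
      have hnn : 0 ≤ 1 - c * ζ k + K ^ 2 / 2 * ζ k ^ 2 := by nlinarith [sq_nonneg (K * ζ k)]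
      refine le_of_sq_le_sq (e3.trans ?_) (by positivity)
      rw [mul_pow]
      refine mul_le_mul_of_nonneg_right ?_ (sq_nonneg _)
      nlinarith [sq_nonneg (-c * ζ k + K ^ 2 / 2 * ζ k ^ 2)]
    have e4 : ‖Δ k - ζ k • B k (R k)‖ ≤ ε k * ζ k * (1 + (‖z‖ + ‖R k‖)) + ζ k * (K * ‖R k‖) := by
      refine (norm_sub_le _ _).trans (add_le_add ((hΔ k).trans ?_) ?_)
      · have := norm_add_le z (R k)
        rw [← hw] at this
        have := mul_nonneg (hε0 k) (hζ k).le
        gcongr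
      · rw [norm_smul, Real.norm_of_nonneg (hζ k).le]
        exact mul_le_mul_of_nonneg_left (hBK k _) (hζ k).le
    rw [e1]
    refine (norm_add_le _ _).trans ((add_le_add e2 e4).trans ?_)
    have hzn := norm_nonneg z
    have hr := norm_nonneg (R k)
    have hζk := (hζ k).le
    have f1 : 0 ≤ ζ k * (K ^ 2 / 2 * ζ k) := by positivity
    have f2 : 0 ≤ ζ k * (K * ‖R k‖) * ‖z‖ := by positivity
    have f3 : 0 ≤ ζ k * (ε k * ‖R k‖) * ‖z‖ := by
      have := hε0 k; positivity
    nlinarith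

/-- One step of a dissipative linear iteration, squared. -/
theorem norm_sq_step_le {B : E →L[ℝ] E} {c K ζ ε : ℝ} (hK : 0 ≤ K) (hζ : 0 ≤ ζ) (hε : 0 ≤ ε)
    {w N Δ : E} (hBc : c * ‖w‖ ^ 2 ≤ ⟪B w, w⟫) (hBK : ‖B w‖ ≤ K * ‖w‖)
    (hN : ‖N‖ ≤ K * (1 + ‖w‖)) (hΔ : ‖Δ‖ ≤ ε * ζ * (1 + ‖w‖)) :
    ‖w - ζ • B w + ζ • N + Δ‖ ^ 2 ≤ (1 - 2 * c * ζ) * ‖w‖ ^ 2 +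
      ζ * ((5 * K ^ 2 * ζ + 4 * (1 + K * ζ) * ε + 4 * ε ^ 2 * ζ) * (1 + ‖w‖ ^ 2)) +
      2 * ζ * ⟪w - ζ • B w, N⟫ := by
  set a := w - ζ • B w with ha
  set x := ‖w‖ with hx
  have hx0 : 0 ≤ x := norm_nonneg _
  have e1 : ‖a‖ ^ 2 ≤ (1 - 2 * c * ζ + K ^ 2 * ζ ^ 2) * x ^ 2 := norm_sub_smul_sq_le hζ w hBc hBK
  have e2 : ‖a‖ ≤ (1 + K * ζ) * x := by
    refine (norm_sub_le _ _).trans ?_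
    rw [norm_smul, Real.norm_of_nonneg hζ]
    nlinarith [mul_le_mul_of_nonneg_left hBK hζ]
  -- The product with the noise is kept exact, since it will have mean zero; all else is estimated.
  -- The constant `5 * K ^ 2` adds the `1` of `e1` to the `4` of `e7`.
  have e3 : ‖a + ζ • N + Δ‖ ^ 2 = ‖a‖ ^ 2 + 2 * ζ * ⟪a, N⟫ + 2 * ⟪a, Δ⟫ + ‖ζ • N + Δ‖ ^ 2 := by
    rw [add_assoc, norm_add_sq_real, inner_add_right, real_inner_smul_right]
    ring
  have e4 : ⟪a, Δ⟫ ≤ (1 + K * ζ) * x * (ε * ζ * (1 + x)) :=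
    (real_inner_le_norm _ _).trans (mul_le_mul e2 hΔ (norm_nonneg _) (by positivity))
  have e5 : ‖ζ • N + Δ‖ ≤ ζ * (K * (1 + x)) + ε * ζ * (1 + x) := by
    refine (norm_add_le _ _).trans (add_le_add ?_ hΔ)
    rw [norm_smul, Real.norm_of_nonneg hζ]
    exact mul_le_mul_of_nonneg_left hN hζ
  have e6 : ‖ζ • N + Δ‖ ^ 2 ≤ (ζ * (K * (1 + x)) + ε * ζ * (1 + x)) ^ 2 := by gcongr
  have e7 : (ζ * (K * (1 + x)) + ε * ζ * (1 + x)) ^ 2 ≤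
      (4 * K ^ 2 * ζ ^ 2 + 4 * ε ^ 2 * ζ ^ 2) * (1 + x ^ 2) := by
    have g1 : (ζ * (K * (1 + x)) + ε * ζ * (1 + x)) ^ 2 = ζ ^ 2 * (K + ε) ^ 2 * (1 + x) ^ 2 := by
      ring
    have g2 : (K + ε) ^ 2 ≤ 2 * (K ^ 2 + ε ^ 2) := by nlinarith [sq_nonneg (K - ε)]
    have g3 : (1 + x) ^ 2 ≤ 2 * (1 + x ^ 2) := by nlinarith [sq_nonneg (1 - x)]
    rw [g1]
    calc ζ ^ 2 * (K + ε) ^ 2 * (1 + x) ^ 2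
        ≤ ζ ^ 2 * (2 * (K ^ 2 + ε ^ 2)) * (2 * (1 + x ^ 2)) := by gcongr
      _ = _ := by ring
  have e8 : (1 + K * ζ) * x * (ε * ζ * (1 + x)) ≤ (1 + K * ζ) * ε * ζ * (2 * (1 + x ^ 2)) := by
    have g : x * (1 + x) ≤ 2 * (1 + x ^ 2) := by nlinarith [sq_nonneg (1 - x)]
    calc (1 + K * ζ) * x * (ε * ζ * (1 + x)) = (1 + K * ζ) * ε * ζ * (x * (1 + x)) := by ring
      _ ≤ _ := by gcongr
  have e9 : 0 ≤ K ^ 2 * ζ ^ 2 := by positivity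
  rw [e3]
  linarith

variable {Ω : Type*} {mΩ : MeasurableSpace Ω} {ℙ : Measure Ω} [IsProbabilityMeasure ℙ]

theorem integrable_of_norm_le {F : Type*} [NormedAddCommGroup F] {f : Ω → F}
    (hf : AEStronglyMeasurable f ℙ) (hb : ∃ C, ∀ ω, ‖f ω‖ ≤ C) : Integrable f ℙ :=
  let ⟨C, hC⟩ := hb
  Integrable.of_bound hf C (ae_of_all _ hC)

/-- The factor known at the earlier time is pulled out of the conditional expectation. -/
theorem condExp_inner_eq_zero [CompleteSpace E] {m : MeasurableSpace Ω} (hm : m ≤ mΩ)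
    {g N : Ω → E} (hg : StronglyMeasurable[m] g) (hgb : ∃ C, ∀ ω, ‖g ω‖ ≤ C)
    (hN : StronglyMeasurable[mΩ] N) (hNb : ∃ C, ∀ ω, ‖N ω‖ ≤ C) (h0 : ℙ[N | m] =ᵐ[ℙ] 0) :
    Integrable (fun ω => ⟪g ω, N ω⟫) ℙ ∧ ℙ[fun ω => ⟪g ω, N ω⟫ | m] =ᵐ[ℙ] 0 := by
  obtain ⟨C, hC⟩ := hgb
  obtain ⟨D, hD⟩ := hNb
  have hint : Integrable (fun ω => ⟪g ω, N ω⟫) ℙ := by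
    refine integrable_of_norm_le
      (((hg.mono hm).inner hN).aestronglyMeasurable) ⟨C * D, fun ω => ?_⟩
    exact (norm_inner_le_norm _ _).trans (mul_le_mul (hC ω) (hD ω) (norm_nonneg _)
      ((norm_nonneg _).trans (hC ω)))
  refine ⟨hint, ?_⟩
  have h : ℙ[fun ω => ⟪g ω, N ω⟫ | m] =ᵐ[ℙ] fun ω => ⟪g ω, (ℙ[N | m]) ω⟫ :=
    condExp_bilin_of_stronglyMeasurable_left (innerSL ℝ : E →L[ℝ] E →L[ℝ] ℝ) hg hint
      (integrable_of_norm_le hN.aestronglyMeasurable ⟨D, hD⟩)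
  filter_upwards [h, h0] with ω h1 h2
  rw [h1, h2]
  simp

/-- Almost sure convergence of dissipative linear stochastic approximation whose noise is a
martingale difference of linear growth, with perturbations that are small compared with the
step sizes. -/
theorem ae_tendsto_zero_of_stochasticApproximation {κ : ℕ} {ℱ : Filtration ℕ mΩ}
    {ζ ε : ℕ → ℝ} {c K : ℝ} (hc : 0 < c) (hK : 0 ≤ K)
    (hζ : ∀ k, 0 < ζ k) (hsum : ¬ Summable ζ) (hsq : Summable fun k => ζ k ^ 2)
    (hε0 : ∀ k, 0 ≤ ε k) (hε : Tendsto ε atTop (𝓝 0))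
    {w N Δ : ℕ → Ω → EuclideanSpace ℝ (Fin κ)}
    {B : ℕ → Ω → EuclideanSpace ℝ (Fin κ) →L[ℝ] EuclideanSpace ℝ (Fin κ)}
    (hw : ∀ k, StronglyMeasurable[ℱ k] (w k)) (hwb : ∀ k, ∃ C, ∀ ω, ‖w k ω‖ ≤ C)
    (hBw : ∀ k, StronglyMeasurable[ℱ k] fun ω => B k ω (w k ω))
    (hN : ∀ k, StronglyMeasurable[ℱ (k + 1)] (N k)) (hNb : ∀ k, ∃ C, ∀ ω, ‖N k ω‖ ≤ C)
    (hN0 : ∀ k, ℙ[N k | ℱ k] =ᵐ[ℙ] 0)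
    (hBc : ∀ k ω u, c * ‖u‖ ^ 2 ≤ ⟪B k ω u, u⟫) (hBK : ∀ k ω u, ‖B k ω u‖ ≤ K * ‖u‖)
    (hrec : ∀ k ω, w (k + 1) ω = w k ω - ζ k • B k ω (w k ω) + ζ k • N k ω + Δ k ω)
    (hNK : ∀ k ω, ‖N k ω‖ ≤ K * (1 + ‖w k ω‖))
    (hΔ : ∀ᵐ ω ∂ℙ, ∀ k, ‖Δ k ω‖ ≤ ε k * ζ k * (1 + ‖w k ω‖)) :
    ∀ᵐ ω ∂ℙ, Tendsto (fun k => w k ω) atTop (𝓝 0) := by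
  have hζ0 : Tendsto ζ atTop (𝓝 0) := by
    have := hsq.tendsto_atTop_zero
    have h2 := this.sqrt
    simpa [Real.sqrt_sq (hζ _).le] using h2
  have hwi : ∀ k, Integrable (fun ω => ‖w k ω‖ ^ 2) ℙ := by
    intro k
    obtain ⟨C, hC⟩ := hwb k
    refine integrable_of_norm_le ((((hw k).mono (ℱ.le k)).norm.pow 2).aestronglyMeasurable)
      ⟨C ^ 2, fun ω => ?_⟩
    rw [Real.norm_of_nonneg (by positivity)]
    have := hC ω
    gcongr
  have hinner : ∀ k (g : Ω → EuclideanSpace ℝ (Fin κ)), StronglyMeasurable[ℱ k] g →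
      (∃ C, ∀ ω, ‖g ω‖ ≤ C) → Integrable (fun ω => ⟪g ω, N k ω⟫) ℙ ∧
        ℙ[fun ω => ⟪g ω, N k ω⟫ | ℱ k] =ᵐ[ℙ] 0 := fun k g hg hgb =>
    condExp_inner_eq_zero (ℱ.le k) hg hgb ((hN k).mono (ℱ.le _)) (hNb k) (hN0 k)
  have hinner0 : ∀ k (g : Ω → EuclideanSpace ℝ (Fin κ)), StronglyMeasurable[ℱ k] g →
      (∃ C, ∀ ω, ‖g ω‖ ≤ C) → ∫ ω, ⟪g ω, N k ω⟫ ∂ℙ = 0 := by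
    intro k g hg hgb
    rw [← integral_condExp (ℱ.le k), integral_congr_ae (hinner k g hg hgb).2]
    simp
  -- second moments of the iterates
  set e : ℕ → ℝ := fun k => ∫ ω, ‖w k ω‖ ^ 2 ∂ℙ with he
  have he0 : ∀ k, 0 ≤ e k := fun k => integral_nonneg fun ω => sq_nonneg _
  -- The expectation of `norm_sq_step_le`, in which the product with the noise drops out.
  have hstep : ∀ k, e (k + 1) ≤ (1 - 2 * c * ζ k) * e k + ζ k *
      ((5 * K ^ 2 * ζ k + 4 * (1 + K * ζ k) * ε k + 4 * ε k ^ 2 * ζ k) * (1 + e k)) := by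
    intro k
    set a : Ω → EuclideanSpace ℝ (Fin κ) := fun ω => w k ω - ζ k • B k ω (w k ω) with ha
    have ham : StronglyMeasurable[ℱ k] a := (hw k).sub ((hBw k).fun_const_smul _)
    have hab : ∃ C, ∀ ω, ‖a ω‖ ≤ C := by
      obtain ⟨C, hC⟩ := hwb k
      refine ⟨C + ζ k * (K * C), fun ω => (norm_sub_le _ _).trans (add_le_add (hC ω) ?_)⟩
      rw [norm_smul, Real.norm_of_nonneg (hζ k).le]
      exact mul_le_mul_of_nonneg_left ((hBK k ω _).trans
        (mul_le_mul_of_nonneg_left (hC ω) hK)) (hζ k).le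
    set η := 5 * K ^ 2 * ζ k + 4 * (1 + K * ζ k) * ε k + 4 * ε k ^ 2 * ζ k with hη
    have i1 : Integrable (fun ω => (1 - 2 * c * ζ k) * ‖w k ω‖ ^ 2) ℙ := (hwi k).const_mul _
    have i2 : Integrable (fun ω => ζ k * (η * (1 + ‖w k ω‖ ^ 2))) ℙ :=
      (((integrable_const 1).add (hwi k)).const_mul η).const_mul (ζ k)
    have i3 : Integrable (fun ω => 2 * ζ k * ⟪a ω, N k ω⟫) ℙ :=
      (hinner k a ham hab).1.const_mul _
    have hle : e (k + 1) ≤ ∫ ω, ((1 - 2 * c * ζ k) * ‖w k ω‖ ^ 2 +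
        ζ k * (η * (1 + ‖w k ω‖ ^ 2)) + 2 * ζ k * ⟪a ω, N k ω⟫) ∂ℙ := by
      refine integral_mono_ae (hwi (k + 1)) ((i1.add i2).add i3) ?_
      filter_upwards [hΔ] with ω hω
      simp only [hrec]
      exact norm_sq_step_le hK (hζ k).le (hε0 k) (hBc k ω _) (hBK k ω _) (hNK k ω) (hω k)
    refine hle.trans (le_of_eq ?_)
    rw [integral_add (f := fun ω => (1 - 2 * c * ζ k) * ‖w k ω‖ ^ 2 +
        ζ k * (η * (1 + ‖w k ω‖ ^ 2))) (i1.add i2) i3, integral_add i1 i2]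
    simp only [integral_const_mul]
    rw [integral_add (integrable_const 1) (hwi k), hinner0 k a ham hab]
    simp [he]
  -- Only `ε → 0` is used, not summability. Of the conclusion, only boundedness of the second
  -- moments is needed below.
  have hetend : Tendsto e atTop (𝓝 0) := by
    refine tendsto_zero_of_le_one_sub_mul_add (c := 2 * c) (by positivity) hζ hζ0 hsum
      (ε := fun k => 5 * K ^ 2 * ζ k + 4 * (1 + K * ζ k) * ε k + 4 * ε k ^ 2 * ζ k) ?_ he0
      (Eventually.of_forall hstep)
    have := ((hζ0.const_mul (5 * K ^ 2)).add
      ((((hζ0.const_mul K).const_add 1).const_mul 4).mul hε)).add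
      (((hε.pow 2).const_mul 4).mul hζ0)
    simpa using this
  obtain ⟨S, hS⟩ : ∃ S, ∀ k, e k ≤ S := by
    obtain ⟨S, hS⟩ := hetend.bddAbove_range
    exact ⟨S, fun k => hS ⟨k, rfl⟩⟩
  -- the accumulated noise
  set m : ℕ → Ω → EuclideanSpace ℝ (Fin κ) :=
    fun n ω => ∑ k ∈ Finset.range n, ζ k • N k ω with hm
  have hmm : ∀ n, StronglyMeasurable[ℱ n] (m n) := by
    intro n
    refine Finset.stronglyMeasurable_fun_sum _ fun k hk => ?_
    exact ((hN k).mono (ℱ.mono (Finset.mem_range.1 hk))).fun_const_smul _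
  have hmb : ∀ n, ∃ C, ∀ ω, ‖m n ω‖ ≤ C := by
    intro n
    choose C hC using hNb
    refine ⟨∑ k ∈ Finset.range n, ζ k * C k, fun ω => norm_sum_le_of_le _ fun k _ => ?_⟩
    rw [norm_smul, Real.norm_of_nonneg (hζ k).le]
    exact mul_le_mul_of_nonneg_left (hC k ω) (hζ k).le
  have hmi : ∀ n, Integrable (fun ω => ‖m n ω‖ ^ 2) ℙ := by
    intro n
    obtain ⟨C, hC⟩ := hmb n
    refine integrable_of_norm_le ((((hmm n).mono (ℱ.le n)).norm.pow 2).aestronglyMeasurable)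
      ⟨C ^ 2, fun ω => ?_⟩
    rw [Real.norm_of_nonneg (by positivity)]
    have := hC ω
    gcongr
  -- Martingale increments are orthogonal, so only the second moments of the single terms add up.
  have hm2 : ∀ n, ∫ ω, ‖m n ω‖ ^ 2 ∂ℙ ≤
      ∑ k ∈ Finset.range n, ζ k ^ 2 * (2 * K ^ 2 * (1 + S)) := by
    intro n
    induction n with
    | zero => simp [hm]
    | succ n ih =>
      have i3 : Integrable (fun ω => 2 * ζ n * ⟪m n ω, N n ω⟫) ℙ :=
        (hinner n (m n) (hmm n) (hmb n)).1.const_mul _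
      have i4 : Integrable (fun ω => ζ n ^ 2 * (2 * K ^ 2 * (1 + ‖w n ω‖ ^ 2))) ℙ :=
        (((integrable_const 1).add (hwi n)).const_mul (2 * K ^ 2)).const_mul (ζ n ^ 2)
      have hle : ∫ ω, ‖m (n + 1) ω‖ ^ 2 ∂ℙ ≤ ∫ ω, (‖m n ω‖ ^ 2 + 2 * ζ n * ⟪m n ω, N n ω⟫ +
          ζ n ^ 2 * (2 * K ^ 2 * (1 + ‖w n ω‖ ^ 2))) ∂ℙ := by
        refine integral_mono (hmi _) (((hmi n).add i3).add i4) fun ω => ?_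
        have e1 : m (n + 1) ω = m n ω + ζ n • N n ω := by simp only [hm, Finset.sum_range_succ]
        simp only [e1, norm_add_sq_real, real_inner_smul_right, norm_smul, mul_pow,
          Real.norm_of_nonneg (hζ n).le]
        have e2 : ‖N n ω‖ ^ 2 ≤ (K * (1 + ‖w n ω‖)) ^ 2 := by
          have := hNK n ω
          gcongr
        have e3 : (K * (1 + ‖w n ω‖)) ^ 2 ≤ 2 * K ^ 2 * (1 + ‖w n ω‖ ^ 2) := by
          nlinarith [mul_nonneg (sq_nonneg K) (sq_nonneg (1 - ‖w n ω‖))]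
        have e4 := mul_le_mul_of_nonneg_left (e2.trans e3) (sq_nonneg (ζ n))
        linarith
      refine hle.trans ?_
      rw [integral_add (f := fun ω => ‖m n ω‖ ^ 2 + 2 * ζ n * ⟪m n ω, N n ω⟫) ((hmi n).add i3) i4,
        integral_add (hmi n) i3]
      simp only [integral_const_mul]
      rw [integral_add (integrable_const 1) (hwi n), hinner0 n (m n) (hmm n) (hmb n),
        Finset.sum_range_succ]
      simp only [integral_const, probReal_univ, one_smul, mul_zero, add_zero]
      have := hS n
      simp only [he] at this
      gcongr
  have hm2' : ∀ n, ∫ ω, ‖m n ω‖ ^ 2 ∂ℙ ≤ (∑' k, ζ k ^ 2) * (2 * K ^ 2 * (1 + S)) := by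
    intro n
    refine (hm2 n).trans ?_
    rw [← Finset.sum_mul]
    have hS0 : 0 ≤ S := (he0 0).trans (hS 0)
    have := hsq.sum_le_tsum (Finset.range n) fun k _ => sq_nonneg (ζ k)
    gcongr
  set Q := (∑' k, ζ k ^ 2) * (2 * K ^ 2 * (1 + S)) with hQ
  -- The martingale convergence theorem is applied to the real coordinates; their `L¹` bound comes
  -- from `|x| ≤ 1 + x²`.
  have hcoord : ∀ i : Fin κ, ∀ᵐ ω ∂ℙ, ∃ x, Tendsto (fun n => m n ω i) atTop (𝓝 x) := by
    intro i
    have hi : ∀ v : EuclideanSpace ℝ (Fin κ), ⟪EuclideanSpace.single i (1 : ℝ), v⟫ = v i := by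
      intro v
      rw [EuclideanSpace.inner_single_left]
      simp
    have hadp : ∀ n, StronglyMeasurable[ℱ n] fun ω => m n ω i := fun n =>
      (EuclideanSpace.proj (𝕜 := ℝ) i).continuous.comp_stronglyMeasurable (hmm n)
    have hcb : ∀ n, ∃ C, ∀ ω, ‖m n ω i‖ ≤ C := fun n =>
      let ⟨C, hC⟩ := hmb n
      ⟨C, fun ω => (PiLp.norm_apply_le _ i).trans (hC ω)⟩
    have hint : ∀ n, Integrable (fun ω => m n ω i) ℙ := fun n =>
      integrable_of_norm_le ((hadp n).mono (ℱ.le n)).aestronglyMeasurable (hcb n)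
    have hmart : Martingale (fun n ω => m n ω i) ℱ ℙ := by
      refine martingale_of_condExp_sub_eq_zero_nat hadp hint fun n => ?_
      have e1 : ((fun ω => m (n + 1) ω i) - fun ω => m n ω i) =
          fun ω => ⟪ζ n • EuclideanSpace.single i (1 : ℝ), N n ω⟫ := by
        ext ω
        simp [hm, Finset.sum_range_succ, real_inner_smul_left, hi]
      rw [e1]
      exact (hinner n (fun _ => ζ n • EuclideanSpace.single i (1 : ℝ))
        stronglyMeasurable_const ⟨_, fun _ => le_rfl⟩).2
    have hbdd : ∀ n, eLpNorm (fun ω => m n ω i) 1 ℙ ≤ ((1 + Q).toNNReal : ENNReal) := by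
      intro n
      rw [eLpNorm_one_eq_lintegral_enorm, ← ofReal_integral_norm_eq_lintegral_enorm (hint n)]
      refine ENNReal.ofReal_le_ofReal ?_
      calc ∫ ω, ‖m n ω i‖ ∂ℙ ≤ ∫ ω, (1 + ‖m n ω‖ ^ 2) ∂ℙ := by
            refine integral_mono (hint n).norm ((integrable_const 1).add (hmi n)) fun ω => ?_
            refine (PiLp.norm_apply_le (m n ω) i).trans ?_
            nlinarith [sq_nonneg (‖m n ω‖ - 1), norm_nonneg (m n ω)]
        _ ≤ 1 + Q := by
            rw [integral_add (integrable_const 1) (hmi n)]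
            simp only [integral_const, probReal_univ, one_smul]
            have := hm2' n
            linarith
    filter_upwards [hmart.submartingale.ae_tendsto_limitProcess hbdd] with ω hω
    exact ⟨_, hω⟩
  filter_upwards [ae_all_iff.2 hcoord, hΔ] with ω hω hωΔ
  choose x hx using hω
  refine tendsto_zero_of_noise_sum_tendsto hc hK hζ hζ0 hsum hε0 hε (fun k => hBc k ω)
    (fun k => hBK k ω) (fun k => hrec k ω) hωΔ (m := WithLp.toLp 2 x) ?_
  have h1 : Tendsto (fun n i => m n ω i) atTop (𝓝 x) := tendsto_pi_nhds.2 hx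
  exact ((PiLp.continuous_toLp 2 _).tendsto x).comp h1

end StochasticApproximation

/-! ### Functions of finitely many discrete observations -/

section FiniteHistory

variable {Ω S β : Type*} {mΩ : MeasurableSpace Ω}

/-- `f` is a function of the first `k` observations. -/
def DependsOnPast (ξ : ℕ → Ω → S) (k : ℕ) (f : Ω → β) : Prop :=
  ∀ ω ω', (∀ j < k, ξ j ω = ξ j ω') → f ω = f ω'

theorem DependsOnPast.exists_eq_comp [Nonempty β] {ξ : ℕ → Ω → S} {k : ℕ} {f : Ω → β}
    (hf : DependsOnPast ξ k f) : ∃ g : (Fin k → S) → β, f = g ∘ fun ω (j : Fin k) => ξ j ω := by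
  refine (Function.factorsThrough_iff f).1 fun ω ω' h => hf ω ω' fun j hj => ?_
  exact congrFun h ⟨j, hj⟩

theorem DependsOnPast.exists_norm_le [Finite S] [NormedAddCommGroup β] {ξ : ℕ → Ω → S} {k : ℕ}
    {f : Ω → β} (hf : DependsOnPast ξ k f) : ∃ C, ∀ ω, ‖f ω‖ ≤ C := by
  obtain ⟨g, rfl⟩ := hf.exists_eq_comp
  obtain ⟨C, hC⟩ := (Set.finite_range fun h => ‖g h‖).bddAbove
  exact ⟨C, fun ω => hC ⟨_, rfl⟩⟩

/-- Such a function factors through a finite discrete space, so the iterates are adapted without any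
regularity of the policy in its parameter. -/
theorem DependsOnPast.stronglyMeasurable [Finite S] [TopologicalSpace β] [Nonempty β]
    {ℱ : Filtration ℕ mΩ} {ξ : ℕ → Ω → S} (hξ : ∀ k η, MeasurableSet[ℱ (k + 1)] (ξ k ⁻¹' {η}))
    {k : ℕ} {f : Ω → β} (hf : DependsOnPast ξ k f) : StronglyMeasurable[ℱ k] f := by
  obtain ⟨g, rfl⟩ := hf.exists_eq_comp
  let _ : MeasurableSpace S := ⊤
  have hH : Measurable[ℱ k] fun ω (j : Fin k) => ξ j ω := by
    refine @measurable_pi_lambda _ _ _ (ℱ k) _ _ fun j => ?_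
    refine @measurable_to_countable' _ _ _ _ (ℱ k) _ fun η => ?_
    exact ℱ.mono (Nat.succ_le_of_lt j.2) _ (hξ j η)
  exact StronglyMeasurable.of_discrete.comp_measurable hH

/-- Splitting by the value of the new observation gives finitely many products of a centered
indicator with a factor known at time `k`. -/
theorem condExp_observation_sub_mean {E : Type*} [NormedAddCommGroup E] [NormedSpace ℝ E]
    [CompleteSpace E] [Fintype S] {ℙ : Measure Ω} [IsProbabilityMeasure ℙ] {ℱ : Filtration ℕ mΩ}
    {ξ : ℕ → Ω → S} (hξ : ∀ k η, MeasurableSet[ℱ (k + 1)] (ξ k ⁻¹' {η})) {k : ℕ}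
    {p : S → Ω → ℝ} (hp : ∀ η, DependsOnPast ξ k (p η))
    (hcond : ∀ η, ℙ[(ξ k ⁻¹' {η}).indicator (fun _ => (1 : ℝ)) | ℱ k] =ᵐ[ℙ] p η)
    {s : S → Ω → E} (hs : ∀ η, DependsOnPast ξ k (s η)) :
    ℙ[fun ω => s (ξ k ω) ω - ∑ η, p η ω • s η ω | ℱ k] =ᵐ[ℙ] 0 := by
  classical
  have hm := ℱ.le k
  have hpm : ∀ η, StronglyMeasurable[ℱ k] (p η) := fun η => (hp η).stronglyMeasurable hξ
  have hsm : ∀ η, StronglyMeasurable[ℱ k] (s η) := fun η => (hs η).stronglyMeasurable hξ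
  have hpi : ∀ η, Integrable (p η) ℙ := fun η =>
    integrable_of_norm_le ((hpm η).mono hm).aestronglyMeasurable (hp η).exists_norm_le
  set I : S → Ω → ℝ := fun η => (ξ k ⁻¹' {η}).indicator fun _ => (1 : ℝ) with hI
  have hIi : ∀ η, Integrable (I η) ℙ := fun η =>
    (integrable_const 1).indicator (ℱ.le _ _ (hξ k η))
  have hterm : ∀ η, Integrable (fun ω => (I η - p η) ω • s η ω) ℙ := by
    intro η
    obtain ⟨C, hC⟩ := (hs η).exists_norm_le
    exact ((hIi η).sub (hpi η)).smul_bdd C ((hsm η).mono hm).aestronglyMeasurable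
      (ae_of_all _ hC)
  have hzero : ∀ η, ℙ[fun ω => (I η - p η) ω • s η ω | ℱ k] =ᵐ[ℙ] 0 := by
    intro η
    have h1 : ℙ[fun ω => (I η - p η) ω • s η ω | ℱ k] =ᵐ[ℙ]
        fun ω => (ℙ[I η - p η | ℱ k]) ω • s η ω :=
      condExp_bilin_of_stronglyMeasurable_right (ContinuousLinearMap.lsmul ℝ ℝ) (hsm η)
        (hterm η) ((hIi η).sub (hpi η))
    have h2 := condExp_sub (hIi η) (hpi η) (ℱ k)
    rw [condExp_of_stronglyMeasurable hm (hpm η) (hpi η)] at h2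
    filter_upwards [h1, h2, hcond η] with ω e1 e2 e3
    rw [e1, e2, Pi.sub_apply, e3]
    simp
  have hsum : (fun ω => s (ξ k ω) ω - ∑ η, p η ω • s η ω) =
      ∑ η, fun ω => (I η - p η) ω • s η ω := by
    ext1 ω
    simp only [Finset.sum_apply, Pi.sub_apply, sub_smul, Finset.sum_sub_distrib, hI]
    congr 1
    rw [Fintype.sum_eq_single (ξ k ω)]
    · simp
    · intro η hη
      rw [Set.indicator_of_notMem (by simpa using hη.symm), zero_smul]
  rw [hsum]
  refine (condExp_finsetSum (fun η _ => hterm η) (ℱ k)).trans ?_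
  filter_upwards [ae_all_iff.2 hzero] with ω hω
  rw [Finset.sum_apply]
  exact Finset.sum_eq_zero fun η _ => hω η

end FiniteHistory

/-! ### Euclidean projections -/

section NearestPoint

/-- The parallelogram law at the midpoint. Uniqueness turns the relational projection steps into
functions of the past. -/
theorem IsNearest.unique {E : Type*} [NormedAddCommGroup E] [InnerProductSpace ℝ E] {K : Set E}
    (hK : Convex ℝ K) {z p q : E} (hp : IsNearest K z p) (hq : IsNearest K z q) : p = q := by
  have hm : (1 / 2 : ℝ) • p + (1 / 2 : ℝ) • q ∈ K :=
    hK hp.1 hq.1 (by norm_num) (by norm_num) (by norm_num)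
  have h1 := hp.2 q hq.1
  have h2 := hq.2 p hp.1
  have h3 := hp.2 _ hm
  have e1 : z - ((1 / 2 : ℝ) • p + (1 / 2 : ℝ) • q) = (1 / 2 : ℝ) • ((z - p) + (z - q)) := by
    module
  have e2 : p - q = (z - q) - (z - p) := by abel
  have h4 := parallelogram_law_with_norm ℝ (z - q) (z - p)
  rw [← e2] at h4
  rw [e1, norm_smul, add_comm (z - p)] at h3
  norm_num at h3
  have h5 : ‖z - q‖ = ‖z - p‖ := le_antisymm h2 h1
  rw [h5] at h4
  have h6 : ‖p - q‖ * ‖p - q‖ ≤ 0 := by nlinarith [norm_nonneg (z - p)]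
  have h7 : ‖p - q‖ = 0 := by nlinarith [norm_nonneg (p - q)]
  exact sub_eq_zero.1 (norm_eq_zero.1 h7)

/-- The point `x` itself competes for being nearest; convexity plays no role. -/
theorem IsNearest.norm_sub_le {E : Type*} [NormedAddCommGroup E] {K : Set E} {x d p : E}
    (hx : x ∈ K) (hp : IsNearest K (x + d) p) : ‖x - p‖ ≤ 2 * ‖d‖ := by
  have h := hp.2 x hx
  rw [add_sub_cancel_left] at h
  have e : x - p = (x + d - p) - d := by abel
  rw [e]
  exact (_root_.norm_sub_le _ _).trans (by linarith)

end NearestPoint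

/-! ### Lipschitz bounds on compact convex sets -/

section LipschitzOnCompact

variable {E F : Type*} [NormedAddCommGroup E] [NormedSpace ℝ E] [NormedAddCommGroup F]
  [NormedSpace ℝ F]

theorem exists_fderiv_bound {K : Set E} (hK : IsCompact K) {f : E → F}
    (hf : ∀ x ∈ K, ContDiffAt ℝ 1 f x) : ∃ C, ∀ x ∈ K, ‖fderiv ℝ f x‖ ≤ C :=
  hK.exists_bound_of_continuousOn fun x hx =>
    ((hf x hx).fderiv_right (m := 0) (by norm_num)).continuousAt.continuousWithinAt

/-- The derivative is bounded by compactness, and convexity allows the mean value inequality. -/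
theorem exists_norm_sub_le_of_contDiffAt {K : Set E} (hK : IsCompact K) (hconv : Convex ℝ K)
    {f : E → F} (hf : ∀ x ∈ K, ContDiffAt ℝ 1 f x) :
    ∃ C, 0 ≤ C ∧ ∀ x ∈ K, ∀ y ∈ K, ‖f x - f y‖ ≤ C * ‖x - y‖ := by
  obtain ⟨C, hC⟩ := exists_fderiv_bound hK hf
  refine ⟨max C 0, le_max_right _ _, fun x hx y hy => ?_⟩
  exact hconv.norm_image_sub_le_of_norm_fderiv_le
    (fun z hz => (hf z hz).differentiableAt (by norm_num))
    (fun z hz => (hC z hz).trans (le_max_left _ _)) hy hx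

theorem exists_nonneg_uniform_bound {ι : Type*} [Finite ι] {P : ι → ℝ → Prop}
    (hmono : ∀ i C C', C ≤ C' → P i C → P i C') (h : ∀ i, ∃ C, P i C) :
    ∃ C, 0 ≤ C ∧ ∀ i, P i C := by
  choose C hC using h
  obtain ⟨B, hB⟩ := (Set.finite_range C).bddAbove
  exact ⟨max B 0, le_max_right _ _, fun i => hmono i _ _ ((hB ⟨i, rfl⟩).trans (le_max_left _ _))
    (hC i)⟩

end LipschitzOnCompact

namespace ChanceMDP

/-! ### Uniform bounds for increments and drift -/

section Bounds

variable {X A : Type*} [Fintype X] [Fintype A] (M : ChanceMDP X A) {T κ κ' : ℕ}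
  (φ : X × ℝ → EuclideanSpace ℝ (Fin κ))

theorem abs_lin_le (v : EuclideanSpace ℝ (Fin κ)) (y : X × ℝ) : |lin φ v y| ≤ ‖φ y‖ * ‖v‖ :=
  abs_real_inner_le_norm _ _

variable (T) in
theorem exists_abs_tdError_le (Λ : ℝ) : ∃ G, 0 ≤ G ∧ ∀ (i : Episode X A T × Fin (T + 1)) (lam : ℝ),
    |lam| ≤ Λ → ∀ v, |M.tdError φ lam v i.1 i.2| ≤ G * (1 + ‖v‖) := by
  classical
  have := (Fintype.finite inferInstance : Finite (Episode X A T))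
  refine exists_nonneg_uniform_bound (fun i C C' hC h lam hlam v => (h lam hlam v).trans
    (mul_le_mul_of_nonneg_right hC (by positivity))) fun i => ?_
  obtain ⟨ξ, h⟩ := i
  set y := M.stateAt ξ h.castSucc
  set y' := M.stateAt ξ h.succ
  refine ⟨|M.C y.1 (ξ h.castSucc).2| + Λ + ‖φ y'‖ + ‖φ y‖, fun lam hlam v => ?_⟩
  have hΛ : 0 ≤ Λ := (abs_nonneg _).trans hlam
  have e1 : |M.augCost lam y (ξ h.castSucc).2| ≤ |M.C y.1 (ξ h.castSucc).2| + Λ := by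
    unfold augCost
    have := abs_nonneg (M.C y.1 (ξ h.castSucc).2)
    split_ifs
    · linarith
    · rw [abs_zero]; linarith
    · linarith
  have e2 : |if (ξ h.castSucc).1 = M.xTar then 0 else lin φ v y'| ≤ ‖φ y'‖ * ‖v‖ := by
    split_ifs
    · rw [abs_zero]; positivity
    · exact abs_lin_le φ v y'
  have e3 := abs_lin_le φ v y
  have e4 : |M.tdError φ lam v ξ h| ≤ (|M.C y.1 (ξ h.castSucc).2| + Λ) + ‖φ y'‖ * ‖v‖ +
      ‖φ y‖ * ‖v‖ := by
    refine (abs_sub _ _).trans (add_le_add ((abs_add_le _ _).trans (add_le_add e1 ?_)) e3)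
    convert e2
  refine e4.trans ?_
  have f1 : 0 ≤ (|M.C y.1 (ξ h.castSucc).2| + Λ) * ‖v‖ := by positivity
  nlinarith [norm_nonneg (φ y), norm_nonneg (φ y')]

variable (T) in
theorem exists_norm_criticStep_le (Λ : ℝ) : ∃ G, 0 ≤ G ∧ ∀ (ξ : Episode X A T) (lam : ℝ),
    |lam| ≤ Λ → ∀ v, ‖M.criticStep φ lam v ξ‖ ≤ G * (1 + ‖v‖) := by
  classical
  have := (Fintype.finite inferInstance : Finite (Episode X A T))
  obtain ⟨G, hG0, hG⟩ := M.exists_abs_tdError_le T φ Λ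
  refine exists_nonneg_uniform_bound (fun i C C' hC h lam hlam v => (h lam hlam v).trans
    (mul_le_mul_of_nonneg_right hC (by positivity))) fun ξ => ?_
  refine ⟨∑ h ∈ M.stages ξ, G * ‖φ (M.stateAt ξ h.castSucc)‖, fun lam hlam v => ?_⟩
  rw [Finset.sum_mul]
  refine norm_sum_le_of_le _ fun h _ => ?_
  rw [norm_smul, mul_right_comm]
  exact mul_le_mul_of_nonneg_right (hG (ξ, h) lam hlam v) (norm_nonneg _)

variable (T) in
-- The multiplier enters only through the cost at the target, so the bound does not grow with `v`.
theorem exists_norm_criticStep_sub_le : ∃ G, 0 ≤ G ∧ ∀ (ξ : Episode X A T) (lam lam' : ℝ) v,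
    ‖M.criticStep φ lam v ξ - M.criticStep φ lam' v ξ‖ ≤ G * |lam - lam'| := by
  classical
  have := (Fintype.finite inferInstance : Finite (Episode X A T))
  refine exists_nonneg_uniform_bound (fun i C C' hC h lam lam' v => (h lam lam' v).trans
    (mul_le_mul_of_nonneg_right hC (abs_nonneg _))) fun ξ => ?_
  refine ⟨∑ h ∈ M.stages ξ, ‖φ (M.stateAt ξ h.castSucc)‖, fun lam lam' v => ?_⟩
  simp only [criticStep]
  rw [← Finset.sum_sub_distrib, Finset.sum_mul]
  refine norm_sum_le_of_le _ fun h _ => ?_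
  rw [← sub_smul, norm_smul, mul_comm]
  refine mul_le_mul_of_nonneg_left ?_ (norm_nonneg _)
  have e : M.tdError φ lam v ξ h - M.tdError φ lam' v ξ h =
      M.augCost lam (M.stateAt ξ h.castSucc) (ξ h.castSucc).2 -
        M.augCost lam' (M.stateAt ξ h.castSucc) (ξ h.castSucc).2 := by
    simp only [tdError]; ring
  rw [e, augCost, augCost, Real.norm_eq_abs]
  split_ifs <;> simp

/-- Bounds for the mean critic increment, uniform over a family of policies. -/
theorem exists_norm_meanStep_le {κ' : ℕ} {K : Set (EuclideanSpace ℝ (Fin κ'))} (hK : IsCompact K)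
    {μ : EuclideanSpace ℝ (Fin κ') → X × ℝ → A → ℝ}
    (hcont : ∀ ξ : Episode X A T, ContinuousOn (fun θ => M.episodeProb (μ θ) ξ) K) (Λ : ℝ) :
    ∃ G, 0 ≤ G ∧ (∀ (ξ : Episode X A T), ∀ θ ∈ K, |M.episodeProb (μ θ) ξ| ≤ G) ∧
      (∀ (ξ : Episode X A T) (lam : ℝ), |lam| ≤ Λ → ∀ v,
        ‖M.criticStep φ lam v ξ‖ ≤ G * (1 + ‖v‖)) ∧
      (∀ θ ∈ K, ∀ lam, |lam| ≤ Λ → ∀ v, ‖M.meanStep T φ (μ θ) lam v‖ ≤ G * (1 + ‖v‖)) ∧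
      ∀ θ ∈ K, ∀ u, ‖M.drift T φ (μ θ) u‖ ≤ G * ‖u‖ := by
  classical
  have := (Fintype.finite inferInstance : Finite (Episode X A T))
  obtain ⟨P, hP0, hP⟩ := exists_nonneg_uniform_bound
    (P := fun (ξ : Episode X A T) C => ∀ θ ∈ K, |M.episodeProb (μ θ) ξ| ≤ C)
    (fun i C C' hC h θ hθ => (h θ hθ).trans hC)
    fun ξ => hK.exists_bound_of_continuousOn (hcont ξ)
  obtain ⟨G₁, hG₁0, hG₁⟩ := M.exists_norm_criticStep_le T φ Λ
  obtain ⟨G₂, hG₂0, hG₂⟩ := exists_nonneg_uniform_bound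
    (P := fun (ξ : Episode X A T) C => ‖M.criticLin φ ξ‖ ≤ C)
    (fun i C C' hC h => h.trans hC) fun ξ => ⟨_, le_rfl⟩
  set m : ℝ := ((Fintype.card (Episode X A T) : ℕ) : ℝ)
  have hsum : ∀ θ ∈ K, ∀ (f : Episode X A T → EuclideanSpace ℝ (Fin κ)) (B : ℝ), (∀ ξ, ‖f ξ‖ ≤ B) →
      ‖∑ ξ, M.episodeProb (μ θ) ξ • f ξ‖ ≤ m * P * B := by
    intro θ hθ f B hf
    have : ∀ ξ ∈ Finset.univ, ‖M.episodeProb (μ θ) ξ • f ξ‖ ≤ P * B := fun ξ _ => by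
      rw [norm_smul]
      exact mul_le_mul (hP ξ θ hθ) (hf ξ) (norm_nonneg _) hP0
    refine (norm_sum_le_of_le _ this).trans (le_of_eq ?_)
    simp [m, mul_assoc]
  have hm : 0 ≤ m := Nat.cast_nonneg _
  have hle₁ : P ≤ P + G₁ + m * P * G₁ + m * P * G₂ := by
    have : 0 ≤ G₁ + m * P * G₁ + m * P * G₂ := by positivity
    linarith
  have hle₂ : G₁ ≤ P + G₁ + m * P * G₁ + m * P * G₂ := by
    have : 0 ≤ P + m * P * G₁ + m * P * G₂ := by positivity
    linarith
  have hle₃ : m * P * G₁ ≤ P + G₁ + m * P * G₁ + m * P * G₂ := by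
    have : 0 ≤ P + G₁ + m * P * G₂ := by positivity
    linarith
  have hle₄ : m * P * G₂ ≤ P + G₁ + m * P * G₁ + m * P * G₂ := by
    have : 0 ≤ P + G₁ + m * P * G₁ := by positivity
    linarith
  -- One constant, the sum of the four, serves all estimates.
  refine ⟨P + G₁ + m * P * G₁ + m * P * G₂, by positivity, fun ξ θ hθ => (hP ξ θ hθ).trans hle₁,
    fun ξ lam hlam v => (hG₁ ξ lam hlam v).trans ?_, fun θ hθ lam hlam v => ?_, fun θ hθ u => ?_⟩
  · exact mul_le_mul_of_nonneg_right hle₂ (by positivity)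
  · refine (hsum θ hθ _ _ fun ξ => hG₁ ξ lam hlam v).trans ?_
    rw [← mul_assoc]
    exact mul_le_mul_of_nonneg_right hle₃ (by positivity)
  · have h1 : M.drift T φ (μ θ) u = -∑ ξ : Episode X A T,
        M.episodeProb (μ θ) ξ • M.criticLin φ ξ u := by
      simp [drift]
    rw [h1, norm_neg]
    refine (hsum θ hθ (fun ξ => M.criticLin φ ξ u) (G₂ * ‖u‖) fun ξ => ?_).trans ?_
    · exact (M.criticLin φ ξ).le_of_opNorm_le (hG₂ ξ) u
    · rw [← mul_assoc]
      exact mul_le_mul_of_nonneg_right hle₄ (norm_nonneg _)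

variable {M φ} in
/-- The mean critic dynamics are uniformly dissipative over compact sets of parameters. -/
theorem HittingTimeBounded.exists_inner_drift_ge (hT : M.HittingTimeBounded T)
    {K : Set (EuclideanSpace ℝ (Fin κ'))} (hK : IsCompact K)
    {μ : EuclideanSpace ℝ (Fin κ') → X × ℝ → A → ℝ}
    (hμ : ∀ θ ∈ K, IsPolicyOn (M.augStates T) (μ θ))
    (hφ : ∀ θ ∈ K, M.IndependentFeatures T (μ θ) φ)
    (hcont : ∀ ξ : Episode X A T, ContinuousOn (fun θ => M.episodeProb (μ θ) ξ) K) :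
    ∃ c, 0 < c ∧ ∀ θ ∈ K, ∀ u, c * ‖u‖ ^ 2 ≤ ⟪M.drift T φ (μ θ) u, u⟫ := by
  classical
  set S : Set (EuclideanSpace ℝ (Fin κ') × EuclideanSpace ℝ (Fin κ)) :=
    K ×ˢ Metric.sphere 0 1 with hS
  have hScomp : IsCompact S := hK.prod (isCompact_sphere _ _)
  have hg : ContinuousOn (fun p : EuclideanSpace ℝ (Fin κ') × EuclideanSpace ℝ (Fin κ) =>
      ⟪M.drift T φ (μ p.1) p.2, p.2⟫) S := by
    have e : ∀ p : EuclideanSpace ℝ (Fin κ') × EuclideanSpace ℝ (Fin κ),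
        M.drift T φ (μ p.1) p.2 = -∑ ξ : Episode X A T,
          M.episodeProb (μ p.1) ξ • M.criticLin φ ξ p.2 := by
      intro p; simp [drift]
    simp only [e]
    refine ContinuousOn.inner ?_ continuousOn_snd
    refine (continuousOn_finsetSum _ fun ξ _ => ?_).neg
    refine ContinuousOn.smul ((hcont ξ).comp continuousOn_fst fun p hp => hp.1) ?_
    exact (M.criticLin φ ξ).continuous.comp_continuousOn continuousOn_snd
  -- A positive continuous function on the compact product with the unit sphere has a positive
  -- minimum; the product may be empty, for instance if `κ = 0`.
  obtain ⟨c, hc, hcS⟩ : ∃ c : ℝ, 0 < c ∧ ∀ p ∈ S, c ≤ ⟪M.drift T φ (μ p.1) p.2, p.2⟫ := by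
    rcases S.eq_empty_or_nonempty with h0 | h0
    · exact ⟨1, one_pos, by simp [h0]⟩
    · obtain ⟨p, hp, hmin⟩ := hScomp.exists_isMinOn h0 hg
      refine ⟨_, hT.inner_drift_pos (hμ p.1 hp.1) (hφ p.1 hp.1) (u := p.2) ?_, fun q hq => hmin hq⟩
      rintro h
      have := hp.2
      simp [h] at this
  refine ⟨c, hc, fun θ hθ u => ?_⟩
  by_cases hu : u = 0
  · simp [hu]
  have hn : ‖u‖ ≠ 0 := norm_ne_zero_iff.2 hu
  have h1 := hcS (θ, ‖u‖⁻¹ • u) ⟨hθ, by simp [norm_smul, hn]⟩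
  simp only [map_smul, real_inner_smul_left, real_inner_smul_right] at h1
  have h2 := mul_le_mul_of_nonneg_right h1 (sq_nonneg ‖u‖)
  refine h2.trans (le_of_eq ?_)
  field_simp

variable {M} in
theorem HittingTimeBounded.episodeProb_eq_zero_or [Nonempty A] (hT : M.HittingTimeBounded T)
    (ξ : Episode X A T) :
    (∀ π, M.episodeProb π ξ = 0) ∨ ∀ h, M.stateAt ξ h ∈ M.augStates T :=
  hT.pathProb_eq_zero_or (M.init_mem_augStates T) ξ

variable {M} in
-- Smoothness of the policy is known on `augStates` only; an episode that leaves this set has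
-- probability zero whatever the policy.
theorem HittingTimeBounded.contDiffAt_episodeProb [Nonempty A] (hT : M.HittingTimeBounded T)
    {μ : EuclideanSpace ℝ (Fin κ') → X × ℝ → A → ℝ} {θ : EuclideanSpace ℝ (Fin κ')}
    (hμ : ∀ y ∈ M.augStates T, ∀ a, ContDiffAt ℝ 1 (fun θ' => μ θ' y a) θ) (ξ : Episode X A T) :
    ContDiffAt ℝ 1 (fun θ' => M.episodeProb (μ θ') ξ) θ := by
  rcases hT.episodeProb_eq_zero_or ξ with h | h
  · simp only [h]
    exact contDiffAt_const
  · unfold episodeProb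
    exact (contDiffAt_const.mul (contDiffAt_prod fun i _ => hμ _ (h i) _)).mul contDiffAt_const

variable {M} in
/-- The actor increment has linear growth, except along episodes of probability zero. -/
theorem exists_norm_actorStep_le {K : Set (EuclideanSpace ℝ (Fin κ'))} (hK : IsCompact K)
    {μ : EuclideanSpace ℝ (Fin κ') → X × ℝ → A → ℝ}
    (hμ : ∀ y ∈ M.augStates T, ∀ a, ∀ θ ∈ K,
      0 < μ θ y a ∧ ContDiffAt ℝ 1 (fun θ' => μ θ' y a) θ) (Λ : ℝ) :
    ∃ G, 0 ≤ G ∧ ∀ (ξ : Episode X A T), (∀ h, M.stateAt ξ h ∈ M.augStates T) →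
      ∀ θ ∈ K, ∀ lam, |lam| ≤ Λ → ∀ v, ‖M.actorStep φ μ lam v θ ξ‖ ≤ G * (1 + ‖v‖) := by
  classical
  have := (Fintype.finite inferInstance : Finite (Episode X A T))
  obtain ⟨G, hG0, hG⟩ := M.exists_abs_tdError_le T φ Λ
  have hgrad : ∀ y ∈ M.augStates T, ∀ a, ∃ C, ∀ θ ∈ K,
      ‖gradient (fun θ' => Real.log (μ θ' y a)) θ‖ ≤ C := by
    intro y hy a
    obtain ⟨C, hC⟩ := exists_fderiv_bound hK (f := fun θ' => Real.log (μ θ' y a))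
      fun θ hθ => ((hμ y hy a θ hθ).2.log (hμ y hy a θ hθ).1.ne')
    exact ⟨C, fun θ hθ => by rw [gradient, LinearIsometryEquiv.norm_map]; exact hC θ hθ⟩
  refine exists_nonneg_uniform_bound (fun i C C' hC h hi θ hθ lam hlam v =>
    (h hi θ hθ lam hlam v).trans (mul_le_mul_of_nonneg_right hC (by positivity))) fun ξ => ?_
  by_cases hξ : ∀ h, M.stateAt ξ h ∈ M.augStates T
  swap
  · exact ⟨0, fun h => absurd h hξ⟩
  choose C hC using fun h : Fin (T + 1) => hgrad _ (hξ h.castSucc) (ξ h.castSucc).2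
  refine ⟨∑ h ∈ M.stages ξ, G * C h, fun _ θ hθ lam hlam v => ?_⟩
  rw [Finset.sum_mul]
  refine norm_sum_le_of_le _ fun h _ => ?_
  rw [norm_smul, mul_right_comm]
  exact mul_le_mul (hG (ξ, h) lam hlam v) (hC h θ hθ) (norm_nonneg _) (by positivity)

end Bounds

/-! ### Boundedness and regularity of the critic limit -/

section CriticLimit

variable {X A : Type*} [Fintype X] [Fintype A] (M : ChanceMDP X A) {T κ κ' : ℕ}
  (φ : X × ℝ → EuclideanSpace ℝ (Fin κ))

variable (T) in
/-- The zero of the mean critic increment. -/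
noncomputable def criticLimit (π : X × ℝ → A → ℝ) (lam : ℝ) : EuclideanSpace ℝ (Fin κ) :=
  Classical.epsilon fun v => M.meanStep T φ π lam v = 0

variable {M φ}

theorem HittingTimeBounded.meanStep_criticLimit (hT : M.HittingTimeBounded T)
    {π : X × ℝ → A → ℝ} (hπ : IsPolicyOn (M.augStates T) π)
    (hφ : M.IndependentFeatures T π φ) (lam : ℝ) :
    M.meanStep T φ π lam (M.criticLimit T φ π lam) = 0 :=
  Classical.epsilon_spec (p := fun v => M.meanStep T φ π lam v = 0)
    (hT.existsUnique_meanStep_eq_zero hπ hφ lam).exists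

variable {K : Set (EuclideanSpace ℝ (Fin κ'))} {μ : EuclideanSpace ℝ (Fin κ') → X × ℝ → A → ℝ}

theorem HittingTimeBounded.meanStep_eq_neg_drift (hT : M.HittingTimeBounded T)
    {π : X × ℝ → A → ℝ} (hπ : IsPolicyOn (M.augStates T) π)
    (hφ : M.IndependentFeatures T π φ) (lam : ℝ) (v : EuclideanSpace ℝ (Fin κ)) :
    M.meanStep T φ π lam v = -M.drift T φ π (v - M.criticLimit T φ π lam) := by
  rw [← M.meanStep_sub φ lam, hT.meanStep_criticLimit hπ hφ, sub_zero]

/-- Strong monotonicity controls the distance to the limit by the mean increment. -/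
theorem HittingTimeBounded.mul_norm_sub_criticLimit_le (hT : M.HittingTimeBounded T)
    {π : X × ℝ → A → ℝ} (hπ : IsPolicyOn (M.augStates T) π)
    (hφ : M.IndependentFeatures T π φ) {c : ℝ}
    (hc : ∀ u, c * ‖u‖ ^ 2 ≤ ⟪M.drift T φ π u, u⟫) (lam : ℝ) (v : EuclideanSpace ℝ (Fin κ)) :
    c * ‖v - M.criticLimit T φ π lam‖ ≤ ‖M.meanStep T φ π lam v‖ := by
  rw [hT.meanStep_eq_neg_drift hπ hφ, norm_neg]
  set u := v - M.criticLimit T φ π lam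
  rcases (norm_nonneg u).eq_or_lt with h0 | h0
  · rw [← h0, mul_zero]; exact norm_nonneg _
  · have := (hc u).trans (real_inner_le_norm _ _)
    rw [sq, ← mul_assoc] at this
    exact le_of_mul_le_mul_right this h0

/-- Strong monotonicity is tested at `v = 0`. -/
theorem HittingTimeBounded.exists_norm_criticLimit_le (hT : M.HittingTimeBounded T)
    (hK : IsCompact K) (hμ : ∀ θ ∈ K, IsPolicyOn (M.augStates T) (μ θ))
    (hφ : ∀ θ ∈ K, M.IndependentFeatures T (μ θ) φ)
    (hcont : ∀ ξ : Episode X A T, ContinuousOn (fun θ => M.episodeProb (μ θ) ξ) K) (Λ : ℝ) :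
    ∃ B, 0 ≤ B ∧ ∀ θ ∈ K, ∀ lam, |lam| ≤ Λ → ‖M.criticLimit T φ (μ θ) lam‖ ≤ B := by
  obtain ⟨c, hc0, hc⟩ := hT.exists_inner_drift_ge hK hμ hφ hcont
  obtain ⟨G, hG0, -, -, hG, -⟩ := M.exists_norm_meanStep_le φ hK hcont Λ
  refine ⟨G / c, by positivity, fun θ hθ lam hlam => ?_⟩
  have h1 := hT.mul_norm_sub_criticLimit_le (hμ θ hθ) (hφ θ hθ) (hc θ hθ) lam 0
  have h2 := hG θ hθ lam hlam 0
  rw [zero_sub, norm_neg] at h1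
  rw [le_div_iff₀ hc0, mul_comm]
  simpa using h1.trans h2

/-- The critic limit is Lipschitz in the policy parameter and the multiplier. -/
theorem HittingTimeBounded.exists_norm_criticLimit_sub_le (hT : M.HittingTimeBounded T)
    (hK : IsCompact K) (hconv : Convex ℝ K) (hμ : ∀ θ ∈ K, IsPolicyOn (M.augStates T) (μ θ))
    (hφ : ∀ θ ∈ K, M.IndependentFeatures T (μ θ) φ)
    (hdiff : ∀ ξ : Episode X A T, ∀ θ ∈ K, ContDiffAt ℝ 1 (fun θ => M.episodeProb (μ θ) ξ) θ)
    (Λ : ℝ) : ∃ L, 0 ≤ L ∧ ∀ θ ∈ K, ∀ θ' ∈ K, ∀ lam lam', |lam| ≤ Λ → |lam'| ≤ Λ →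
      ‖M.criticLimit T φ (μ θ) lam - M.criticLimit T φ (μ θ') lam'‖ ≤
        L * (‖θ - θ'‖ + |lam - lam'|) := by
  classical
  have := (Fintype.finite inferInstance : Finite (Episode X A T))
  have hcont : ∀ ξ : Episode X A T, ContinuousOn (fun θ => M.episodeProb (μ θ) ξ) K :=
    fun ξ θ hθ => (hdiff ξ θ hθ).continuousAt.continuousWithinAt
  obtain ⟨c, hc0, hc⟩ := hT.exists_inner_drift_ge hK hμ hφ hcont
  obtain ⟨G, hG0, hGp, hGs, -, -⟩ := M.exists_norm_meanStep_le φ hK hcont Λ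
  obtain ⟨B, hB0, hB⟩ := hT.exists_norm_criticLimit_le hK hμ hφ hcont Λ
  obtain ⟨R, hR0, hR⟩ := M.exists_norm_criticStep_sub_le T φ
  obtain ⟨Q, hQ0, hQ⟩ := exists_nonneg_uniform_bound
    (P := fun (ξ : Episode X A T) C => ∀ θ ∈ K, ∀ θ' ∈ K,
      ‖M.episodeProb (μ θ) ξ - M.episodeProb (μ θ') ξ‖ ≤ C * ‖θ - θ'‖)
    (fun i C C' hC h θ hθ θ' hθ' => (h θ hθ θ' hθ').trans
      (mul_le_mul_of_nonneg_right hC (norm_nonneg _)))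
    fun ξ => by
      obtain ⟨C, -, hC⟩ := exists_norm_sub_le_of_contDiffAt hK hconv (hdiff ξ)
      exact ⟨C, hC⟩
  set m : ℝ := ((Fintype.card (Episode X A T) : ℕ) : ℝ)
  have hm : 0 ≤ m := Nat.cast_nonneg _
  refine ⟨m * (Q * (G * (1 + B)) + G * R) / c, by positivity,
    fun θ hθ θ' hθ' lam lam' hlam hlam' => ?_⟩
  set v := M.criticLimit T φ (μ θ) lam with hv
  have h0 : M.meanStep T φ (μ θ) lam v = 0 := hT.meanStep_criticLimit (hμ θ hθ) (hφ θ hθ) lam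
  -- The limit for `(θ, lam)` is a trial point for `(θ', lam')`. Its mean increment there measures
  -- the distance of the limits, and it is small because it vanishes for `(θ, lam)`.
  have h1 := hT.mul_norm_sub_criticLimit_le (hμ θ' hθ') (hφ θ' hθ') (hc θ' hθ') lam' v
  have h2 : M.meanStep T φ (μ θ') lam' v = -∑ ξ : Episode X A T,
      ((M.episodeProb (μ θ) ξ - M.episodeProb (μ θ') ξ) • M.criticStep φ lam' v ξ +
        M.episodeProb (μ θ) ξ • (M.criticStep φ lam v ξ - M.criticStep φ lam' v ξ)) := by
    rw [← sub_zero (M.meanStep T φ (μ θ') lam' v), ← h0]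
    simp only [meanStep]
    rw [← Finset.sum_sub_distrib, ← Finset.sum_neg_distrib]
    refine Finset.sum_congr rfl fun ξ _ => ?_
    module
  have h3 : ‖M.meanStep T φ (μ θ') lam' v‖ ≤
      m * ((Q * (G * (1 + B)) + G * R) * (‖θ - θ'‖ + |lam - lam'|)) := by
    rw [h2, norm_neg]
    have hterm : ∀ ξ ∈ (Finset.univ : Finset (Episode X A T)),
        ‖(M.episodeProb (μ θ) ξ - M.episodeProb (μ θ') ξ) • M.criticStep φ lam' v ξ +
        M.episodeProb (μ θ) ξ • (M.criticStep φ lam v ξ - M.criticStep φ lam' v ξ)‖ ≤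
        (Q * (G * (1 + B)) + G * R) * (‖θ - θ'‖ + |lam - lam'|) := by
      intro ξ _
      have hvB : ‖v‖ ≤ B := hB θ hθ lam hlam
      have e1 : ‖(M.episodeProb (μ θ) ξ - M.episodeProb (μ θ') ξ) • M.criticStep φ lam' v ξ‖ ≤
          Q * ‖θ - θ'‖ * (G * (1 + B)) := by
        rw [norm_smul]
        refine mul_le_mul (hQ ξ θ hθ θ' hθ') ((hGs ξ lam' hlam' v).trans ?_) (norm_nonneg _)
          (by positivity)
        gcongr
      have e2 : ‖M.episodeProb (μ θ) ξ • (M.criticStep φ lam v ξ - M.criticStep φ lam' v ξ)‖ ≤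
          G * (R * |lam - lam'|) := by
        rw [norm_smul]
        exact mul_le_mul (hGp ξ θ hθ) (hR ξ lam lam' v) (norm_nonneg _) hG0
      refine (norm_add_le _ _).trans ((add_le_add e1 e2).trans ?_)
      have f1 : 0 ≤ G * R * ‖θ - θ'‖ := by positivity
      have f2 : 0 ≤ Q * (G * (1 + B)) * |lam - lam'| := by positivity
      linarith
    refine (norm_sum_le_of_le _ hterm).trans (le_of_eq ?_)
    simp [m]
  rw [div_mul_eq_mul_div, le_div_iff₀ hc0, mul_comm]
  exact (h1.trans h3).trans (le_of_eq (by ring))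

end CriticLimit

/-! ### The critic as a perturbed stochastic approximation -/

section Tracking

variable {X A : Type*} [Fintype X] [Fintype A] {M : ChanceMDP X A} {T κ κ' : ℕ}
  {φ : X × ℝ → EuclideanSpace ℝ (Fin κ)} {K : Set (EuclideanSpace ℝ (Fin κ'))}
  {μ : EuclideanSpace ℝ (Fin κ') → X × ℝ → A → ℝ}

/-- The critic tracks its limit along slowly varying parameters. -/
theorem HittingTimeBounded.ae_tendsto_critic_sub (hT : M.HittingTimeBounded T)
    (hK : IsCompact K) (hμ : ∀ θ ∈ K, IsPolicyOn (M.augStates T) (μ θ))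
    (hφ : ∀ θ ∈ K, M.IndependentFeatures T (μ θ) φ)
    (hcont : ∀ ξ : Episode X A T, ContinuousOn (fun θ => M.episodeProb (μ θ) ξ) K) {Λ : ℝ}
    {ζ ε : ℕ → ℝ} (hζ : ∀ k, 0 < ζ k) (hsum : ¬ Summable ζ) (hsq : Summable fun k => ζ k ^ 2)
    (hε0 : ∀ k, 0 ≤ ε k) (hε : Tendsto ε atTop (𝓝 0))
    {Ω : Type*} {mΩ : MeasurableSpace Ω} {ℙ : Measure Ω} [IsProbabilityMeasure ℙ]
    {ℱ : Filtration ℕ mΩ} {θ : ℕ → Ω → EuclideanSpace ℝ (Fin κ')} {lam : ℕ → Ω → ℝ}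
    {v : ℕ → Ω → EuclideanSpace ℝ (Fin κ)} {ξ : ℕ → Ω → Episode X A T}
    (hrun : IsCriticRun M φ μ ζ ℙ ℱ θ lam v ξ)
    (hpast : ∀ k, DependsOnPast ξ k (θ k) ∧ DependsOnPast ξ k (lam k) ∧ DependsOnPast ξ k (v k))
    (hθK : ∀ k ω, θ k ω ∈ K) (hlam : ∀ k ω, |lam k ω| ≤ Λ)
    (hslow : ∀ᵐ ω ∂ℙ, ∀ k, ‖M.criticLimit T φ (μ (θ k ω)) (lam k ω) -
      M.criticLimit T φ (μ (θ (k + 1) ω)) (lam (k + 1) ω)‖ ≤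
        ε k * ζ k * (1 + ‖v k ω - M.criticLimit T φ (μ (θ k ω)) (lam k ω)‖)) :
    ∀ᵐ ω ∂ℙ, Tendsto (fun k => v k ω - M.criticLimit T φ (μ (θ k ω)) (lam k ω)) atTop (𝓝 0) := by
  classical
  have := (Fintype.finite inferInstance : Finite (Episode X A T))
  obtain ⟨c, hc0, hc⟩ := hT.exists_inner_drift_ge hK hμ hφ hcont
  obtain ⟨G, hG0, -, hGs, hGm, hGd⟩ := M.exists_norm_meanStep_le φ hK hcont Λ
  obtain ⟨B, hB0, hB⟩ := hT.exists_norm_criticLimit_le hK hμ hφ hcont Λ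
  have hmeas := hrun.measurable
  set w : ℕ → Ω → EuclideanSpace ℝ (Fin κ) :=
    fun k ω => v k ω - M.criticLimit T φ (μ (θ k ω)) (lam k ω) with hw
  set N : ℕ → Ω → EuclideanSpace ℝ (Fin κ) := fun k ω =>
    M.criticStep φ (lam k ω) (v k ω) (ξ k ω) - M.meanStep T φ (μ (θ k ω)) (lam k ω) (v k ω)
    with hN
  have hpw : ∀ k, DependsOnPast ξ k (w k) := fun k ω ω' h => by
    simp only [hw, (hpast k).1 ω ω' h, (hpast k).2.1 ω ω' h, (hpast k).2.2 ω ω' h]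
  have hpN : ∀ k, DependsOnPast ξ (k + 1) (N k) := fun k ω ω' h => by
    have h' : ∀ j < k, ξ j ω = ξ j ω' := fun j hj => h j (by omega)
    simp only [hN, (hpast k).1 ω ω' h', (hpast k).2.1 ω ω' h', (hpast k).2.2 ω ω' h',
      h k (Nat.lt_succ_self k)]
  -- The noise is a difference of two terms bounded by `G * (1 + ‖v‖)`, and `1 + ‖v‖ ≤ (1 + B) * (1
  -- + ‖w‖)`; hence the growth constant `2 * G * (1 + B)`.
  refine ae_tendsto_zero_of_stochasticApproximation (ℱ := ℱ) (w := w) (N := N)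
    (Δ := fun k ω => M.criticLimit T φ (μ (θ k ω)) (lam k ω) -
      M.criticLimit T φ (μ (θ (k + 1) ω)) (lam (k + 1) ω))
    (B := fun k ω => M.drift T φ (μ (θ k ω))) (K := 2 * G * (1 + B)) hc0 (by positivity)
    hζ hsum hsq hε0 hε
    (fun k => (hpw k).stronglyMeasurable hmeas) (fun k => (hpw k).exists_norm_le) (fun k => ?_)
    (fun k => (hpN k).stronglyMeasurable hmeas) (fun k => (hpN k).exists_norm_le) (fun k => ?_)
    (fun k ω => hc _ (hθK k ω)) (fun k ω u => ?_) (fun k ω => ?_) (fun k ω => ?_) hslow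
  · refine DependsOnPast.stronglyMeasurable hmeas fun ω ω' h => ?_
    simp only [(hpast k).1 ω ω' h, hpw k ω ω' h]
  · exact condExp_observation_sub_mean hmeas (p := fun η ω => M.episodeProb (μ (θ k ω)) η)
      (s := fun η ω => M.criticStep φ (lam k ω) (v k ω) η)
      (fun η ω ω' h => by simp only [(hpast k).1 ω ω' h]) (hrun.sample k)
      (fun η ω ω' h => by simp only [(hpast k).2.1 ω ω' h, (hpast k).2.2 ω ω' h])
  · refine (hGd _ (hθK k ω) u).trans (mul_le_mul_of_nonneg_right ?_ (norm_nonneg _))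
    nlinarith
  · have h1 := hT.meanStep_eq_neg_drift (hμ _ (hθK k ω)) (hφ _ (hθK k ω)) (lam k ω) (v k ω)
    have h2 : M.drift T φ (μ (θ k ω)) (w k ω) =
        -M.meanStep T φ (μ (θ k ω)) (lam k ω) (v k ω) := by rw [h1, neg_neg]
    rw [h2]
    simp only [hw, hN, hrun.update k ω, smul_neg, smul_sub]
    abel
  · have h1 := hGs (ξ k ω) _ (hlam k ω) (v k ω)
    have h2 := hGm _ (hθK k ω) _ (hlam k ω) (v k ω)
    have h3 : ‖v k ω‖ ≤ ‖w k ω‖ + B := by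
      have e : v k ω = w k ω + M.criticLimit T φ (μ (θ k ω)) (lam k ω) := by simp [hw]
      rw [e]
      exact (norm_add_le _ _).trans (add_le_add_right (hB _ (hθK k ω) _ (hlam k ω)) _)
    have h4 : 1 + ‖v k ω‖ ≤ (1 + B) * (1 + ‖w k ω‖) := by
      nlinarith [norm_nonneg (w k ω)]
    calc ‖N k ω‖ ≤ G * (1 + ‖v k ω‖) + G * (1 + ‖v k ω‖) := (norm_sub_le _ _).trans (add_le_add h1 h2)
      _ = 2 * G * (1 + ‖v k ω‖) := by ring
      _ ≤ 2 * G * ((1 + B) * (1 + ‖w k ω‖)) := by gcongr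
      _ = _ := by ring

theorem dependsOnPast_critic {ζ : ℕ → ℝ} {Ω : Type*} {mΩ : MeasurableSpace Ω} {ℙ : Measure Ω}
    {ℱ : Filtration ℕ mΩ} {θ : EuclideanSpace ℝ (Fin κ')} {lam : ℝ}
    {v : ℕ → Ω → EuclideanSpace ℝ (Fin κ)} {ξ : ℕ → Ω → Episode X A T}
    (hrun : IsCriticRun M φ μ ζ ℙ ℱ (fun _ _ => θ) (fun _ _ => lam) v ξ) (k : ℕ) :
    DependsOnPast ξ k (v k) := by
  induction k with
  | zero =>
    obtain ⟨v₀, hv₀⟩ := hrun.init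
    intro ω ω' _
    rw [hv₀, hv₀]
  | succ k ih =>
    intro ω ω' h
    rw [hrun.update, hrun.update, ih ω ω' fun j hj => h j (by omega), h k (Nat.lt_succ_self k)]

theorem dependsOnPast_actorCritic {ζ₁ ζ₂ ζ₃ : ℕ → ℝ} {lamMax β : ℝ} (hconv : Convex ℝ K)
    {Ω : Type*} {mΩ : MeasurableSpace Ω}
    {ℙ : Measure Ω} {ℱ : Filtration ℕ mΩ} {θ : ℕ → Ω → EuclideanSpace ℝ (Fin κ')}
    {lam : ℕ → Ω → ℝ} {v : ℕ → Ω → EuclideanSpace ℝ (Fin κ)} {ξ : ℕ → Ω → Episode X A T}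
    (hrun : IsCriticRun M φ μ ζ₃ ℙ ℱ θ lam v ξ)
    (hact : IsActorRun M φ μ ζ₁ ζ₂ K lamMax β θ lam v ξ) (k : ℕ) :
    DependsOnPast ξ k (θ k) ∧ DependsOnPast ξ k (lam k) ∧ DependsOnPast ξ k (v k) := by
  induction k with
  | zero =>
    obtain ⟨v₀, hv₀⟩ := hrun.init
    obtain ⟨θ₀, -, lam₀, -, h0⟩ := hact.init
    exact ⟨fun ω ω' _ => by rw [(h0 ω).1, (h0 ω').1], fun ω ω' _ => by rw [(h0 ω).2, (h0 ω').2],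
      fun ω ω' _ => by rw [hv₀, hv₀]⟩
  | succ k ih =>
    have key : ∀ ω ω', (∀ j < k + 1, ξ j ω = ξ j ω') →
        θ k ω = θ k ω' ∧ lam k ω = lam k ω' ∧ v k ω = v k ω' ∧ ξ k ω = ξ k ω' := fun ω ω' h =>
      have h' : ∀ j < k, ξ j ω = ξ j ω' := fun j hj => h j (by omega)
      ⟨ih.1 ω ω' h', ih.2.1 ω ω' h', ih.2.2 ω ω' h', h k (Nat.lt_succ_self k)⟩
    refine ⟨fun ω ω' h => ?_, fun ω ω' h => ?_, fun ω ω' h => ?_⟩ <;>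
      obtain ⟨h1, h2, h3, h4⟩ := key ω ω' h
    · have e := hact.update_θ k ω
      rw [h1, h2, h3, h4] at e
      exact e.unique hconv (hact.update_θ k ω')
    · have e := hact.update_lam k ω
      rw [h2, h4] at e
      exact e.unique (convex_Icc 0 lamMax) (hact.update_lam k ω')
    · rw [hrun.update, hrun.update, h2, h3, h4]

/-- Along a critic run, almost surely no episode of zero probability is sampled. -/
theorem ae_episodeProb_ne_zero {ζ : ℕ → ℝ} {Ω : Type*} {mΩ : MeasurableSpace Ω} {ℙ : Measure Ω}
    [IsProbabilityMeasure ℙ]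
    {ℱ : Filtration ℕ mΩ} {θ : ℕ → Ω → EuclideanSpace ℝ (Fin κ')}
    {lam : ℕ → Ω → ℝ} {v : ℕ → Ω → EuclideanSpace ℝ (Fin κ)} {ξ : ℕ → Ω → Episode X A T}
    (hrun : IsCriticRun M φ μ ζ ℙ ℱ θ lam v ξ) :
    ∀ᵐ ω ∂ℙ, ∀ k, ¬ ∀ π, M.episodeProb π (ξ k ω) = 0 := by
  classical
  rw [ae_all_iff]
  intro k
  have h : ∀ η : Episode X A T, ∀ᵐ ω ∂ℙ, (∀ π, M.episodeProb π η = 0) → ξ k ω ≠ η := by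
    intro η
    by_cases h0 : ∀ π, M.episodeProb π η = 0
    swap
    · exact ae_of_all _ fun ω h => absurd h h0
    have hm : MeasurableSet (ξ k ⁻¹' {η}) := ℱ.le _ _ (hrun.measurable k η)
    have h1 : ∫ ω, (ξ k ⁻¹' {η}).indicator (fun _ => (1 : ℝ)) ω ∂ℙ = 0 := by
      rw [← integral_condExp (ℱ.le k), integral_congr_ae (hrun.sample k η)]
      simp [h0]
    rw [integral_indicator hm] at h1
    have h2 : ℙ (ξ k ⁻¹' {η}) = 0 := by
      simpa [measureReal_def, ENNReal.toReal_eq_zero_iff, measure_ne_top] using h1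
    have h3 : ∀ᵐ ω ∂ℙ, ω ∉ ξ k ⁻¹' {η} := measure_eq_zero_iff_ae_notMem.1 h2
    filter_upwards [h3] with ω hω _ using hω
  have := (Fintype.finite inferInstance : Finite (Episode X A T))
  filter_upwards [ae_all_iff.2 h] with ω hω h0
  exact hω (ξ k ω) h0 rfl

end Tracking

end ChanceMDP

namespace ChanceMDP

/-! ### Frozen parameters and the full actor-critic iteration -/

section ActorCritic

variable {X A : Type*} [Fintype X] [Fintype A] {M : ChanceMDP X A} {T κ κ' : ℕ}
  {φ : X × ℝ → EuclideanSpace ℝ (Fin κ)} {Θ : Set (EuclideanSpace ℝ (Fin κ'))}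
  {μ : EuclideanSpace ℝ (Fin κ') → X × ℝ → A → ℝ}

/-- With the parameter set `{θ}` the limit does not move, so the perturbation is zero. -/
theorem HittingTimeBounded.ae_tendsto_critic (hT : M.HittingTimeBounded T)
    {θ : EuclideanSpace ℝ (Fin κ')} (hμ : IsPolicyOn (M.augStates T) (μ θ))
    (hφ : M.IndependentFeatures T (μ θ) φ) {lam : ℝ}
    {ζ : ℕ → ℝ} (hζ : ∀ k, 0 < ζ k) (hsum : ¬ Summable ζ) (hsq : Summable fun k => ζ k ^ 2)
    {Ω : Type*} {mΩ : MeasurableSpace Ω} {ℙ : Measure Ω} [IsProbabilityMeasure ℙ]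
    {ℱ : Filtration ℕ mΩ}
    {v : ℕ → Ω → EuclideanSpace ℝ (Fin κ)} {ξ : ℕ → Ω → Episode X A T}
    (hrun : IsCriticRun M φ μ ζ ℙ ℱ (fun _ _ => θ) (fun _ _ => lam) v ξ) :
    ∀ᵐ ω ∂ℙ, Tendsto (fun k => v k ω) atTop (𝓝 (M.criticLimit T φ (μ θ) lam)) := by
  have h := hT.ae_tendsto_critic_sub (K := {θ}) (μ := μ) isCompact_singleton
    (by rintro _ rfl; exact hμ) (by rintro _ rfl; exact hφ)
    (fun ξ => continuousOn_singleton _ _) (Λ := |lam|) hζ hsum hsq (ε := fun _ => 0)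
    (fun _ => le_rfl) tendsto_const_nhds hrun
    (fun k => ⟨fun _ _ _ => rfl, fun _ _ _ => rfl, dependsOnPast_critic hrun k⟩)
    (fun _ _ => rfl) (fun _ _ => le_rfl) (ae_of_all _ fun ω k => by simp)
  filter_upwards [h] with ω hω
  simpa using hω.add_const (M.criticLimit T φ (μ θ) lam)

/-- Projected actor steps have size `O((ζ₁ + ζ₂) (1 + ‖w‖))` and the limit is Lipschitz, so relative
to `ζ₃` its motion is negligible. -/
theorem HittingTimeBounded.ae_tendsto_actorCritic (hT : M.HittingTimeBounded T)
    (hμ : ∀ θ ∈ Θ, IsPolicyOn (M.augStates T) (μ θ))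
    (hφ : ∀ θ ∈ Θ, M.IndependentFeatures T (μ θ) φ)
    {ζ₁ ζ₂ ζ₃ : ℕ → ℝ} (hζ : StepSizes ζ₁ ζ₂ ζ₃)
    {Ω : Type*} {mΩ : MeasurableSpace Ω} {ℙ : Measure Ω} [IsProbabilityMeasure ℙ]
    {ℱ : Filtration ℕ mΩ} (hΘ : IsCompact Θ) (hconv : Convex ℝ Θ)
    (hdiff : ∀ y ∈ M.augStates T, ∀ a, ∀ θ ∈ Θ,
      0 < μ θ y a ∧ ContDiffAt ℝ 1 (fun θ' => μ θ' y a) θ)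
    {lamMax β : ℝ} {θ : ℕ → Ω → EuclideanSpace ℝ (Fin κ')} {lam : ℕ → Ω → ℝ}
    {v : ℕ → Ω → EuclideanSpace ℝ (Fin κ)} {ξ : ℕ → Ω → Episode X A T}
    (hrun : IsCriticRun M φ μ ζ₃ ℙ ℱ θ lam v ξ)
    (hact : IsActorRun M φ μ ζ₁ ζ₂ Θ lamMax β θ lam v ξ) :
    ∀ᵐ ω ∂ℙ, Tendsto (fun k => v k ω - M.criticLimit T φ (μ (θ k ω)) (lam k ω)) atTop (𝓝 0) := by
  obtain ⟨θ₀, hθ₀, lam₀, hlam₀, hinit⟩ := hact.init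
  have hA : Nonempty A := M.nonempty_of_isPolicyOn (hμ θ₀ hθ₀)
  have hθmem : ∀ k ω, θ k ω ∈ Θ := by
    rintro (_ | k) ω
    · rw [(hinit ω).1]; exact hθ₀
    · exact (hact.update_θ k ω).1
  have hlmem : ∀ k ω, lam k ω ∈ Set.Icc 0 lamMax := by
    rintro (_ | k) ω
    · rw [(hinit ω).2]; exact hlam₀
    · exact (hact.update_lam k ω).1
  have hlam : ∀ k ω, |lam k ω| ≤ lamMax := fun k ω => by
    rw [abs_of_nonneg (hlmem k ω).1]; exact (hlmem k ω).2
  have hdiffP : ∀ ξ : Episode X A T, ∀ θ ∈ Θ,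
      ContDiffAt ℝ 1 (fun θ => M.episodeProb (μ θ) ξ) θ := fun ξ θ hθ =>
    hT.contDiffAt_episodeProb (fun y hy a => (hdiff y hy a θ hθ).2) ξ
  have hcont : ∀ ξ : Episode X A T, ContinuousOn (fun θ => M.episodeProb (μ θ) ξ) Θ :=
    fun ξ θ hθ => (hdiffP ξ θ hθ).continuousAt.continuousWithinAt
  obtain ⟨B, hB0, hB⟩ := hT.exists_norm_criticLimit_le hΘ hμ hφ hcont lamMax
  obtain ⟨L, hL0, hL⟩ := hT.exists_norm_criticLimit_sub_le hΘ hconv hμ hφ hdiffP lamMax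
  obtain ⟨Q, hQ0, hQ⟩ := exists_norm_actorStep_le φ hΘ hdiff lamMax
  -- The Lipschitz constant `L` times the sum of both step bounds; the `2` is from
  -- `IsNearest.norm_sub_le`.
  set c := 2 * L * (Q * (1 + B) + (|β| + 1)) with hc
  have hc0 : 0 ≤ c := by positivity
  have h1 := fun k => (hζ.pos k).1
  have h2 := fun k => (hζ.pos k).2.1
  have h3 := fun k => (hζ.pos k).2.2
  have hε : Tendsto (fun k => c * (ζ₁ k / ζ₃ k + ζ₂ k / ζ₃ k)) atTop (𝓝 0) := by
    have := ((hζ.isLittleO₁₂.trans hζ.isLittleO₂₃).tendsto_div_nhds_zero.add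
      hζ.isLittleO₂₃.tendsto_div_nhds_zero).const_mul c
    simpa using this
  refine hT.ae_tendsto_critic_sub hΘ hμ hφ hcont (Λ := lamMax) h3 hζ.not_summable.2.2
    hζ.sq_summable.2.2 (fun k => ?_) hε hrun (dependsOnPast_actorCritic hconv hrun hact) hθmem
    hlam ?_
  · have := h1 k
    have := h2 k
    have := h3 k
    positivity
  -- Off a null set all episodes stay in `augStates`, where the score function is bounded.
  filter_upwards [ae_episodeProb_ne_zero hrun] with ω hω k
  have hgood := (hT.episodeProb_eq_zero_or (ξ k ω)).resolve_left (hω k)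
  set w := v k ω - M.criticLimit T φ (μ (θ k ω)) (lam k ω) with hw
  have hv : 1 + ‖v k ω‖ ≤ (1 + B) * (1 + ‖w‖) := by
    have e : v k ω = w + M.criticLimit T φ (μ (θ k ω)) (lam k ω) := by simp [hw]
    have := norm_add_le w (M.criticLimit T φ (μ (θ k ω)) (lam k ω))
    rw [← e] at this
    have := hB _ (hθmem k ω) _ (hlam k ω)
    nlinarith [norm_nonneg w]
  have hθstep : ‖θ k ω - θ (k + 1) ω‖ ≤ 2 * (ζ₂ k * (Q * ((1 + B) * (1 + ‖w‖)))) := by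
    have e := hact.update_θ k ω
    rw [sub_eq_add_neg] at e
    refine (e.norm_sub_le (hθmem k ω)).trans ?_
    rw [norm_neg, norm_smul, Real.norm_of_nonneg (h2 k).le]
    have := hQ (ξ k ω) hgood _ (hθmem k ω) _ (hlam k ω) (v k ω)
    have := h2 k
    gcongr
    exact ‹‖M.actorStep φ μ (lam k ω) (v k ω) (θ k ω) (ξ k ω)‖ ≤ _›.trans (by gcongr)
  have hlstep : |lam k ω - lam (k + 1) ω| ≤ 2 * (ζ₁ k * ((|β| + 1) * (1 + ‖w‖))) := by
    refine ((hact.update_lam k ω).norm_sub_le (hlmem k ω)).trans ?_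
    rw [norm_mul, Real.norm_of_nonneg (h1 k).le]
    have e : ‖-β + if M.sTar (ξ k ω) ≤ 0 then (1 : ℝ) else 0‖ ≤ |β| + 1 := by
      refine (norm_add_le _ _).trans (add_le_add (by simp) ?_)
      split_ifs <;> simp
    have := h1 k
    gcongr
    refine e.trans (le_mul_of_one_le_right (by positivity) ?_)
    linarith [norm_nonneg w]
  refine (hL _ (hθmem k ω) _ (hθmem (k + 1) ω) _ _ (hlam k ω) (hlam (k + 1) ω)).trans ?_
  have hprod : c * (ζ₁ k / ζ₃ k + ζ₂ k / ζ₃ k) * ζ₃ k * (1 + ‖w‖) =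
      c * (ζ₁ k + ζ₂ k) * (1 + ‖w‖) := by
    have := (h3 k).ne'
    field_simp
  rw [hprod]
  refine (mul_le_mul_of_nonneg_left (add_le_add hθstep hlstep) hL0).trans ?_
  have f1 : 0 ≤ L * ζ₁ k * (Q * (1 + B)) * (1 + ‖w‖) := by
    have := h1 k
    positivity
  have f2 : 0 ≤ L * ζ₂ k * (|β| + 1) * (1 + ‖w‖) := by
    have := h2 k
    positivity
  rw [hc]
  linarith

end ActorCritic

end ChanceMDP

theorem mainTheorem5 {X A : Type*} [Fintype X] [Fintype A] (M : ChanceMDP X A)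
    (T : ℕ) (hT : M.HittingTimeBounded T)
    {κ κ' : ℕ} (φ : X × ℝ → EuclideanSpace ℝ (Fin κ))
    (Θ : Set (EuclideanSpace ℝ (Fin κ')))
    (μ : EuclideanSpace ℝ (Fin κ') → X × ℝ → A → ℝ)
    (hμ : ∀ θ ∈ Θ, IsPolicyOn (M.augStates T) (μ θ))
    (hφ : ∀ θ ∈ Θ, M.IndependentFeatures T (μ θ) φ)
    (ζ₁ ζ₂ ζ₃ : ℕ → ℝ) (hζ : StepSizes ζ₁ ζ₂ ζ₃)
    {Ω : Type*} {mΩ : MeasurableSpace Ω} (ℙ : Measure Ω) [IsProbabilityMeasure ℙ]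
    (ℱ : Filtration ℕ mΩ) :
    ∃ vstar : EuclideanSpace ℝ (Fin κ') → ℝ → EuclideanSpace ℝ (Fin κ),
      -- the limit: the unique projected Bellman fixed point
      (∀ θ ∈ Θ, ∀ lam : ℝ, 0 ≤ lam →
        (∀ v, M.IsProjFixedPoint T (μ θ) lam φ v ↔ v = vstar θ lam) ∧
        (∀ v, IsMinOn (M.projResidual T (μ θ) lam φ) Set.univ v ↔ v = vstar θ lam) ∧
        ((∃ v, M.residual T (μ θ) lam φ v = 0) →
          ∀ v, IsMinOn (M.residual T (μ θ) lam φ) Set.univ v ↔ v = vstar θ lam)) ∧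
      -- the critic for a given policy parameter and multiplier
      (∀ θ ∈ Θ, ∀ lam : ℝ, 0 ≤ lam →
        ∀ (v : ℕ → Ω → EuclideanSpace ℝ (Fin κ)) (ξ : ℕ → Ω → Episode X A T),
          IsCriticRun M φ μ ζ₃ ℙ ℱ (fun _ _ => θ) (fun _ _ => lam) v ξ →
          ∀ᵐ ω ∂ℙ, Tendsto (fun k => v k ω) atTop (𝓝 (vstar θ lam))) ∧
      -- the critic inside the actor-critic algorithm
      (IsCompact Θ → Convex ℝ Θ →
        (∀ y ∈ M.augStates T, ∀ a, ∀ θ ∈ Θ,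
          0 < μ θ y a ∧ ContDiffAt ℝ 1 (fun θ' => μ θ' y a) θ) →
        ∀ (lamMax β : ℝ) (θ : ℕ → Ω → EuclideanSpace ℝ (Fin κ')) (lam : ℕ → Ω → ℝ)
          (v : ℕ → Ω → EuclideanSpace ℝ (Fin κ)) (ξ : ℕ → Ω → Episode X A T),
          IsCriticRun M φ μ ζ₃ ℙ ℱ θ lam v ξ →
          IsActorRun M φ μ ζ₁ ζ₂ Θ lamMax β θ lam v ξ →
          ∀ᵐ ω ∂ℙ, Tendsto (fun k => v k ω - vstar (θ k ω) (lam k ω)) atTop (𝓝 0)) := by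
  refine ⟨fun θ lam => M.criticLimit T φ (μ θ) lam, fun θ hθ lam _ => ?_,
    fun θ hθ lam _ v ξ hrun => ?_, fun hΘ hconv hdiff lamMax β θ lam v ξ hrun hact => ?_⟩
  · exact hT.fixedPoint_characterization (hμ θ hθ) (hφ θ hθ)
      (hT.meanStep_criticLimit (hμ θ hθ) (hφ θ hθ) lam)
  · exact hT.ae_tendsto_critic (hμ θ hθ) (hφ θ hθ) (fun k => (hζ.pos k).2.2)
      hζ.not_summable.2.2 hζ.sq_summable.2.2 hrun
  · exact hT.ae_tendsto_actorCritic hμ hφ hζ hΘ hconv hdiff hrun hact
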